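/- Let $n\ge 1$ and let $V$ be a measurable $n\times n$ complex matrix function on $\mathbb R^+=(0,\infty)$ with $V(x)^\dagger=V(x)$ for all $x>0$ and $V\in L^1_1(\mathbb R^+)$, where $L^1_\epsilon(\mathbb R^+)$ is the set of measurable $V$ with $\int_0^\infty(1+x)^\epsilon|V(x)|\,dx<\infty$ and $|\cdot|$ is the operator norm. Let $A,B$ be constant $n\times n$ complex matrices with $$-B^\dagger A+A^\dagger B=0,\qquad A^\dagger A+B^\dagger B>0 .\tag{1}$$ A solution of $-\psi''+V\psi=k^2\psi$ means a differentiable $n\times n$ matrix function $\psi$ on $[0,\infty)$ with $\psi'$ absolutely continuous on each $[0,b]$, satisfying the equation almost everywhere. For $k\in\mathbb C$ let $\varphi(k,x)$ be the regular solution, i.e. the solution with $\varphi(k,0)=A$, $\varphi'(k,0)=B$; for $k\ne0$ with $\operatorname{Im}k\ge0$ let $f(k,x)$ be the Jost solution, i.e. the solution with $f(k,x)=e^{ikx}[I+o(1)]$ as $x\to+\infty$; and let $J(k)=f(-k^*,0)^\dagger B-f'(-k^*,0)^\dagger A$ be the Jost matrix, where $k^*$ is the complex conjugate of $k$. Let $k=i\kappa_N$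 with $\kappa_N>0$ be a bound state, i.e. $\det J(i\kappa_N)=0$. Let $Q_N$ be the orthogonal projection of $\mathbb C^n$ onto $\operatorname{Ker}J(i\kappa_N)$, and put $$\mathbf G_N=\int_0^\infty Q_N\varphi(i\kappa_N,x)^\dagger\varphi(i\kappa_N,x)Q_N\,dx,\quad \mathbf H_N=I-Q_N+\mathbf G_N,\quad C_N=\mathbf H_N^{-1/2}Q_N,$$ $$\Phi_N(x)=\varphi(i\kappa_N,x)C_N,\qquad W_N(x)=\int_x^\infty\Phi_N(z)^\dagger\Phi_N(z)\,dz,\qquad \mathcal A(x,y)=\Phi_N(x)W_N(x)^+\Phi_N(y)^\dagger,$$ where $W_N(x)^+$ is the Moore--Penrose inverse of $W_N(x)$. Define $$\tilde V(x)=V(x)+2\,\frac{d}{dx}\left[\Phi_N(x)W_N(x)^+\Phi_N(x)^\dagger\right],\qquad \tilde\varphi(k,x)=\varphi(k,x)+\int_0^x\mathcal A(x,y)\,\varphi(k,y)\,dy .$$ Then the derivative in the definition of $\tilde V$ exists for every $x>0$, and the following hold. (a) For every $k\in\mathbb C$, $\tilde\varphi(k,\cdot)$ is a solution of $-\psi''+\tilde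 V\psi=k^2\psi$, and for all $x\ge0$ $$\tilde\varphi(k,x)=\varphi(k,x)+\Phi_N(x)W_N(x)^+\int_0^x\Phi_N(y)^\dagger\varphi(k,y)\,dy .$$ (b) $\tilde V(x)^\dagger=\tilde V(x)$ for all $x>0$, and $\tilde V(x)-V(x)=O\!\left(\int_x^\infty|V(y)|\,dy\right)$ as $x\to+\infty$. If $V\in L^1_{1+\epsilon}(\mathbb R^+)$ for some $\epsilon\ge0$, then $\tilde V\in L^1_\epsilon(\mathbb R^+)$. (c) If $|V(x)|\le c\,e^{-\alpha x}$ for almost every $x\ge x_0$, with some $\alpha,x_0>0$ and a constant $c$, then there is a constant $c'$ with $|\tilde V(x)-V(x)|\le c'e^{-\alpha x}$ for all $x\ge x_0$. (d) If the support of $V$ is contained in $[0,x_0]$ for some $x_0>0$, then so is the support of $\tilde V$. This holds both in the almost-everywhere sense ($V=0$ for almost every $x>x_0$ implies the same for $\tilde V$) and pointwise. (e) For every $k\in\mathbb C$ with $k\ne\pm i\kappa_N$ and all $x\ge0$, $$\tilde\varphi(k,x)=\varphi(k,x)+\frac1{k^2+\kappa_N^2}\,\Phi_N(x)W_N(x)^+\left[\Phi_N'(x)^\dagger\varphi(k,x)-\Phi_N(x)^\dagger\varphi'(k,x)\right].$$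 (f) For every $k\in\mathbb C$, $\tilde\varphi(k,0)=\tilde A$ and $\tilde\varphi'(k,0)=\tilde B$, where $\tilde A=A$ and $\tilde B=B+A\,C_N^2A^\dagger A$. (g) $\tilde A,\tilde B$ satisfy (1) in place of $A,B$. Hence, for every $k\in\mathbb C$, $\tilde\varphi(k,\cdot)$ is the regular solution of the equation with potential $\tilde V$ and boundary matrices $\tilde A,\tilde B$, and it satisfies the boundary condition $-\tilde B^\dagger\psi(0)+\tilde A^\dagger\psi'(0)=0$. -/

import Mathlib

open Set Filter Topology MeasureTheory
open scoped Matrix Matrix.Norms.L2Operator MatrixOrder ComplexOrder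

namespace MatrixSchrodinger

/-- Complex `n × n` matrices. The norm in force on them is the operator norm of matrices acting on
Euclidean `ℂⁿ`. -/
abbrev Mat (n : ℕ) : Type := Matrix (Fin n) (Fin n) ℂ

/-- The spaces `L¹_ε(ℝ⁺)` of measurable matrix functions on `(0,∞)` with
`∫_0^∞ (1+x)^ε |V(x)| dx < ∞`. -/
def InWeightedL1 {n : ℕ} (ε : ℝ) (V : ℝ → Mat n) : Prop :=
  AEStronglyMeasurable V (volume.restrict (Ioi 0)) ∧
    IntegrableOn (fun x : ℝ => (1 + x) ^ ε * ‖V x‖) (Ioi 0)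

/-- The `x`-derivative of a function on the closed half line `[0,∞)`: the ordinary derivative for
`x > 0` and the right derivative at `x = 0`. -/
noncomputable def hderiv {n : ℕ} (ψ : ℝ → Mat n) (x : ℝ) : Mat n :=
  derivWithin ψ (Ici 0) x

/-- `ψ` is an `n × n` matrix solution of `-ψ'' + V ψ = k² ψ` on the half line, in the usual sense
for an integrable potential: `ψ` is differentiable on `[0,∞)`, the derivative `ψ'` is absolutely
continuous on each `[0,b]`, and the equation, i.e. `ψ'' = V ψ - k² ψ`, holds almost everywhere. -/
structure IsSolution {n : ℕ} (V : ℝ → Mat n) (k : ℂ) (ψ : ℝ → Mat n) : Prop where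
  differentiableOn : DifferentiableOn ℝ ψ (Ici 0)
  absolutelyContinuous : ∀ b : ℝ, 0 < b → AbsolutelyContinuousOnInterval (hderiv ψ) 0 b
  equation : ∀ᵐ x ∂volume.restrict (Ioi (0 : ℝ)),
    HasDerivAt (hderiv ψ) (V x * ψ x - k ^ 2 • ψ x) x

/-- The algebraic conditions on the boundary matrices of a selfadjoint boundary condition. -/
structure IsBoundaryPair {n : ℕ} (A B : Mat n) : Prop where
  selfadjoint : -Bᴴ * A + Aᴴ * B = 0
  posDef : (Aᴴ * A + Bᴴ * B).PosDef

/-- The boundary condition `-B† ψ(0) + A† ψ'(0) = 0`. -/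
def SatisfiesBoundaryCondition {n : ℕ} (A B : Mat n) (ψ : ℝ → Mat n) : Prop :=
  -Bᴴ * ψ 0 + Aᴴ * hderiv ψ 0 = 0

/-- `ψ = φ(k, ·)` is the regular solution: `ψ(0) = A` and `ψ'(0) = B`. -/
structure IsRegularSolution {n : ℕ} (V : ℝ → Mat n) (A B : Mat n) (k : ℂ) (ψ : ℝ → Mat n) :
    Prop where
  isSolution : IsSolution V k ψ
  value_zero : ψ 0 = A
  deriv_zero : hderiv ψ 0 = B

/-- `ψ = f(k, ·)` is the Jost solution: `ψ(x) = e^{ikx} [I + o(1)]` as `x → +∞`. -/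
structure IsJostSolution {n : ℕ} (V : ℝ → Mat n) (k : ℂ) (ψ : ℝ → Mat n) : Prop where
  isSolution : IsSolution V k ψ
  asymptotics :
    Tendsto (fun x : ℝ => Complex.exp (-(Complex.I * k * x)) • ψ x) atTop (𝓝 1)

/-- The Jost matrix `J(k) = f(-k*, 0)† B - f'(-k*, 0)† A`. -/
noncomputable def jostMatrix {n : ℕ} (f : ℂ → ℝ → Mat n) (A B : Mat n) (k : ℂ) : Mat n :=
  (f (-(star k)) 0)ᴴ * B - (hderiv (f (-(star k))) 0)ᴴ * A

/-- The matrix of the orthogonal projection of `ℂⁿ` onto the kernel of `M`. -/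
noncomputable def kerProjection {n : ℕ} (M : Mat n) : Mat n :=
  (Matrix.toEuclideanCLM (n := Fin n) (𝕜 := ℂ)).symm
    (LinearMap.ker (Matrix.toEuclideanLin M)).starProjection

/-- The four equalities that characterize the Moore--Penrose inverse `X` of `M`. -/
structure IsMoorePenroseInverse {n : ℕ} (M X : Mat n) : Prop where
  mul_mul_self : M * X * M = M
  self_mul_mul : X * M * X = X
  isHermitian_mul : (M * X)ᴴ = M * X
  isHermitian_mul' : (X * M)ᴴ = X * M

/-- A hermitian matrix has a generalized inverse that commutes with it. -/
theorem exists_inverse_of_isSelfAdjoint {n : ℕ} (M : Mat n) (hM : IsSelfAdjoint M) :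
    ∃ X : Mat n, IsSelfAdjoint X ∧ M * X * M = M ∧ X * M * X = X ∧ M * X = X * M := by
  have hc : ∀ g : ℝ → ℝ, ContinuousOn g (spectrum ℝ M) := fun g =>
    (Matrix.finite_real_spectrum (A := M)).continuousOn g
  have hid : cfc (fun x : ℝ => x) M = M := cfc_id' ℝ M
  have h1 : M * cfc (fun x : ℝ => x⁻¹) M = cfc (fun x : ℝ => x * x⁻¹) M := by
    rw [cfc_mul _ _ M (hc _) (hc _), hid]
  have h2 : cfc (fun x : ℝ => x⁻¹) M * M = cfc (fun x : ℝ => x * x⁻¹) M := by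
    rw [← h1]
    nth_rewrite 2 [← hid]
    nth_rewrite 3 [← hid]
    exact cfc_commute_cfc _ _ M
  refine ⟨cfc (fun x : ℝ => x⁻¹) M, cfc_predicate _ M, ?_, ?_, h1.trans h2.symm⟩
  · have h3 : cfc (fun x : ℝ => x * x⁻¹) M * cfc (fun x : ℝ => x) M = cfc (fun x : ℝ => x) M := by
      rw [← cfc_mul _ _ M (hc _) (hc _)]
      congr 1
      ext x
      by_cases h : x = 0 <;> simp [h]
    rw [h1]
    rwa [hid] at h3
  · rw [h2, ← cfc_mul _ _ M (hc _) (hc _)]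
    congr 1
    ext x
    by_cases h : x = 0 <;> simp [h]

theorem exists_isMoorePenroseInverse {n : ℕ} (M : Mat n) :
    ∃ X : Mat n, IsMoorePenroseInverse M X := by
  obtain ⟨N, hN, h1, h2, h3⟩ := exists_inverse_of_isSelfAdjoint (Mᴴ * M)
    (Matrix.isHermitian_conjTranspose_mul_self M)
  have hN' : Nᴴ = N := hN
  have key : M * (N * Mᴴ * M) = M := by
    have h4 : (M * (N * Mᴴ * M) - M)ᴴ * (M * (N * Mᴴ * M) - M) = 0 := by
      have e : (M * (N * Mᴴ * M) - M)ᴴ * (M * (N * Mᴴ * M) - M) =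
          ((Mᴴ * M) * N - 1) * ((Mᴴ * M) * N * (Mᴴ * M) - Mᴴ * M) := by
        simp only [Matrix.conjTranspose_sub, Matrix.conjTranspose_mul,
          Matrix.conjTranspose_conjTranspose, hN']
        noncomm_ring
      rw [e, h1, sub_self, mul_zero]
    exact sub_eq_zero.mp (Matrix.conjTranspose_mul_self_eq_zero.mp h4)
  refine ⟨N * Mᴴ, ?_, ?_, ?_, ?_⟩
  · simpa only [mul_assoc] using key
  · rw [mul_assoc N Mᴴ M, ← mul_assoc, h2]
  · simp only [Matrix.conjTranspose_mul, Matrix.conjTranspose_conjTranspose, hN', mul_assoc]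
  · rw [mul_assoc N Mᴴ M, Matrix.conjTranspose_mul, hN',
      (Matrix.isHermitian_conjTranspose_mul_self M).eq, h3]

/-- The Moore--Penrose inverse `M⁺`. -/
noncomputable def moorePenroseInverse {n : ℕ} (M : Mat n) : Mat n :=
  (exists_isMoorePenroseInverse M).choose

/-- The Gel'fand--Levitan normalization matrix `C = H^{-1/2} Q`, where
`G = ∫_0^∞ Q φ(x)† φ(x) Q dx` and `H = I - Q + G`. -/
noncomputable def glNormalization {n : ℕ} (φ : ℝ → Mat n) (Q : Mat n) : Mat n :=
  (CFC.sqrt (1 - Q + ∫ x in Ioi (0 : ℝ), Q * (φ x)ᴴ * φ x * Q))⁻¹ * Q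

/-- `W(x) = ∫_x^∞ Φ(z)† Φ(z) dz`. -/
noncomputable def tailGram {n : ℕ} (Φ : ℝ → Mat n) (x : ℝ) : Mat n :=
  ∫ z in Ioi x, (Φ z)ᴴ * Φ z

/-- `𝒜(x,y) = Φ(x) W(x)⁺ Φ(y)†`. -/
noncomputable def removalKernel {n : ℕ} (Φ : ℝ → Mat n) (x y : ℝ) : Mat n :=
  Φ x * moorePenroseInverse (tailGram Φ x) * (Φ y)ᴴ

/-- `Ṽ(x) = V(x) + 2 (d/dx) [Φ(x) W(x)⁺ Φ(x)†]`. -/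
noncomputable def perturbedPotential {n : ℕ} (V Φ : ℝ → Mat n) (x : ℝ) : Mat n :=
  V x + (2 : ℝ) • deriv (fun t : ℝ => removalKernel Φ t t) x

/-- `φ̃(x) = φ(x) + ∫_0^x 𝒜(x,y) φ(y) dy`. -/
noncomputable def perturbedSolution {n : ℕ} (Φ φ : ℝ → Mat n) (x : ℝ) : Mat n :=
  φ x + ∫ y in (0 : ℝ)..x, removalKernel Φ x y * φ y

end MatrixSchrodinger

open MatrixSchrodinger

/-!
The transformation `φ ↦ φ̃` is a Darboux transformation in the direction of the decaying solution
`Φ = φ(iκ,·) C`. Write `W(x) = ∫_x^∞ Φ†Φ`, `P = W⁺`, `E = Φ P Φ†`. Two identities make it work.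
Since `W' = -Φ†Φ` and `W` has constant range, that of the projection `Q`, one has `P' = P Φ†Φ P`.
The Wronskian `Φ†Φ' - Φ'†Φ` vanishes. From these, `Φ P` solves the equation at energy `-κ²` with
potential `V + 2E'` (`IsDarbouxData.hasDerivAt_factorDeriv`). The Wronskian of `Φ` and `φ(k,·)`
vanishes at the origin, so it equals `-(k² + κ²) ∫_0^x Φ†φ`; this gives the integral-free form of
`φ̃`, and it also turns the second derivative of `φ + Φ P ∫_0^x Φ†φ` into the equation with
potential `V + 2E'` (`IsDarbouxData.isSolution_transform`).

That `Φ` decays is the meaning of the bound state: `J(iκ)` is the Wronskian of the Jost solution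
`f` and `φ(iκ,·)`, so the columns of `φ(iκ,·) Q` have vanishing Wronskian with `f`, whence
`φ(iκ,·) Q = f K` with a constant matrix `K` (`IsJostSolution.eq_mul_of_wronskian`). Far out this
is because `f⁻¹ φ Q` has derivative zero; uniqueness for the equation, a Grönwall argument with
integrable kernel, extends it to `[0,∞)`.

For the size of `Ṽ - V = 2E'`, put `h = Φ' + κΦ` and `σ(x) = ∫_x^∞ |V|`. The function `e^{-κx} h`
has derivative `e^{-κx} V Φ` and limit zero, so `|h| ≤ G e^{-κx} σ(x)`
(`IsSolution.norm_hderiv_add_le`). Integration gives `|Φ†Φ - 2κW| ≤ G' e^{-2κx} σ(x)`, and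
`2κ e^{2κx} W → K†K` gives `|P| ≤ c e^{2κx}`. Since `E' = h P Φ† + Φ P h† + Φ P (Φ†Φ - 2κW) P Φ†`, the
bound `|E'| ≤ c σ(x)` holds for all `x > 0` (`IsBoundState.exists_norm_diagDeriv_le`), and the
decay statements are properties of `σ` alone.

At the origin, `C = H^{-1/2} Q` is chosen so that `W(0) = C G C = Q`, and so `E(0) = A C² A†`.
-/

namespace MatrixSchrodinger

/-! ### Absolutely continuous functions with values in a normed space -/

section AbsolutelyContinuous

variable {X Y Z : Type*} [PseudoMetricSpace X] [PseudoMetricSpace Y] [PseudoMetricSpace Z]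

/-- A function whose increments are dominated by those of two absolutely continuous functions is
absolutely continuous. Products and Lipschitz images are special cases. -/
theorem _root_.AbsolutelyContinuousOnInterval.of_dist_le {f : ℝ → X} {g : ℝ → Y} {h : ℝ → Z}
    {a b : ℝ} (c d : ℝ) (hf : AbsolutelyContinuousOnInterval f a b)
    (hg : AbsolutelyContinuousOnInterval g a b)
    (hle : ∀ x ∈ uIcc a b, ∀ y ∈ uIcc a b,
      dist (h x) (h y) ≤ c * dist (f x) (f y) + d * dist (g x) (g y)) :
    AbsolutelyContinuousOnInterval h a b := by
  unfold AbsolutelyContinuousOnInterval at hf hg ⊢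
  refine squeeze_zero' ?_ ?_ (by simpa using (hf.const_mul c).add (hg.const_mul d))
  · exact Eventually.of_forall fun _ => Finset.sum_nonneg fun i _ => dist_nonneg
  rw [eventually_inf_principal]
  filter_upwards with E hE
  simp only [Finset.mul_sum, ← Finset.sum_add_distrib]
  refine Finset.sum_le_sum fun i hi => ?_
  simp only [AbsolutelyContinuousOnInterval.disjWithin, mem_ofPred_eq] at hE
  exact hle _ (hE.1 i hi).1 _ (hE.1 i hi).2

end AbsolutelyContinuous

section Ring

variable {R : Type*} [NormedRing R]

theorem _root_.AbsolutelyContinuousOnInterval.ring_mul {f g : ℝ → R} {a b : ℝ}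
    (hf : AbsolutelyContinuousOnInterval f a b) (hg : AbsolutelyContinuousOnInterval g a b) :
    AbsolutelyContinuousOnInterval (fun x => f x * g x) a b := by
  obtain ⟨c, hc⟩ := hf.exists_bound
  obtain ⟨d, hd⟩ := hg.exists_bound
  refine AbsolutelyContinuousOnInterval.of_dist_le d c hf hg fun x hx y hy => ?_
  rw [dist_eq_norm, dist_eq_norm, dist_eq_norm]
  have e : f x * g x - f y * g y = (f x - f y) * g x + f y * (g x - g y) := by noncomm_ring
  rw [e]
  refine (norm_add_le _ _).trans (add_le_add ?_ ?_)
  · rw [mul_comm d]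
    exact (norm_mul_le _ _).trans (mul_le_mul_of_nonneg_left (hd x hx) (norm_nonneg _))
  · exact (norm_mul_le _ _).trans (mul_le_mul_of_nonneg_right (hc y hy) (norm_nonneg _))

theorem _root_.AbsolutelyContinuousOnInterval.star_fun [StarRing R] [NormedStarGroup R] {f : ℝ → R}
    {a b : ℝ} (hf : AbsolutelyContinuousOnInterval f a b) :
    AbsolutelyContinuousOnInterval (fun x => star (f x)) a b := by
  refine AbsolutelyContinuousOnInterval.of_dist_le 1 0 hf hf fun x _ y _ => ?_
  rw [dist_eq_norm, dist_eq_norm, ← star_sub, norm_star]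
  simp

end Ring

section Vector

variable {F : Type*} [NormedAddCommGroup F]

theorem absolutelyContinuousOnInterval_congr {f g : ℝ → F} {a b : ℝ}
    (hf : AbsolutelyContinuousOnInterval f a b) (h : EqOn f g (uIcc a b)) :
    AbsolutelyContinuousOnInterval g a b :=
  AbsolutelyContinuousOnInterval.of_dist_le 1 0 hf hf fun x hx y hy => by
    rw [h hx, h hy]; simp

variable [NormedSpace ℝ F]

theorem absolutelyContinuousOnInterval_integral [CompleteSpace F] {q : ℝ → F} {a b : ℝ}
    (hq : IntervalIntegrable q volume a b) :
    AbsolutelyContinuousOnInterval (fun x => ∫ t in a..x, q t) a b := by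
  have h := hq.norm.absolutelyContinuousOnInterval_intervalIntegral left_mem_uIcc
  refine AbsolutelyContinuousOnInterval.of_dist_le 1 0 h h fun x hx y hy => ?_
  have h1 : ∀ z ∈ uIcc a b, IntervalIntegrable q volume a z := fun z hz =>
    hq.mono_set (uIcc_subset_uIcc left_mem_uIcc hz)
  rw [dist_eq_norm, dist_eq_norm, intervalIntegral.integral_interval_sub_left (h1 x hx) (h1 y hy),
    intervalIntegral.integral_interval_sub_left (h1 x hx).norm (h1 y hy).norm, one_mul, zero_mul,
    add_zero, Real.norm_eq_abs]
  exact intervalIntegral.norm_integral_le_abs_integral_norm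

/-- The fundamental theorem of calculus for vector valued absolutely continuous functions. -/
theorem integral_eq_sub_of_absolutelyContinuous [CompleteSpace F] {f q : ℝ → F} {a b : ℝ}
    (hf : AbsolutelyContinuousOnInterval f a b) (hq : IntervalIntegrable q volume a b)
    (hd : ∀ᵐ x, x ∈ uIcc a b → HasDerivAt f (q x) x) :
    ∫ t in a..b, q t = f b - f a := by
  obtain ⟨c, hc⟩ :=
    (hf.sub (absolutelyContinuousOnInterval_integral hq)).const_of_ae_hasDerivAt_zero (by
      filter_upwards [hd, hq.ae_hasDerivAt_integral] with x h1 h2 hx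
      simpa using (h1 hx).sub (h2 hx a left_mem_uIcc))
  have h1 := hc a left_mem_uIcc
  have h2 := hc b right_mem_uIcc
  simp only [Pi.sub_apply, intervalIntegral.integral_same, sub_zero] at h1 h2
  rw [h1, ← h2]
  abel

/-- A continuously differentiable function on `[0,∞)` is absolutely continuous on `[0,b]`. -/
theorem absolutelyContinuousOnInterval_of_hasDerivWithinAt {f f' : ℝ → F}
    (hf : ∀ x, 0 ≤ x → HasDerivWithinAt f (f' x) (Ici 0) x) (hc : ContinuousOn f' (Ici 0))
    {b : ℝ} (hb : 0 < b) : AbsolutelyContinuousOnInterval f 0 b := by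
  have hsub : uIcc (0 : ℝ) b ⊆ Ici 0 := by
    rw [uIcc_of_le hb.le]; exact Icc_subset_Ici_self
  obtain ⟨c, hc⟩ := isCompact_uIcc.exists_bound_of_continuousOn (hc.mono hsub)
  refine LipschitzOnWith.absolutelyContinuousOnInterval (K := c.toNNReal) ?_
  refine Convex.lipschitzOnWith_of_nnnorm_hasDerivWithin_le (convex_uIcc 0 b)
    (fun x hx => (hf x (hsub hx)).mono hsub) fun x hx => ?_
  rw [← NNReal.coe_le_coe, coe_nnnorm]
  exact (hc x hx).trans (Real.le_coe_toNNReal c)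

theorem eq_zero_value_of_ae_hasDerivAt_zero {f : ℝ → F}
    (hf : ∀ b, 0 < b → AbsolutelyContinuousOnInterval f 0 b)
    (hd : ∀ᵐ x ∂volume.restrict (Ioi (0 : ℝ)), HasDerivAt f 0 x) {x : ℝ} (hx : 0 ≤ x) :
    f x = f 0 := by
  have hb : 0 < x + 1 := by linarith
  have hd' : ∀ᵐ t : ℝ, t ∈ uIcc 0 (x + 1) → HasDerivAt f 0 t := by
    rw [ae_restrict_iff' measurableSet_Ioi] at hd
    filter_upwards [hd, Measure.ae_ne volume (0 : ℝ)] with t h1 h2 ht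
    rw [uIcc_of_le hb.le] at ht
    exact h1 (lt_of_le_of_ne ht.1 (Ne.symm h2))
  obtain ⟨c, hc⟩ := (hf _ hb).const_of_ae_hasDerivAt_zero hd'
  rw [hc x (by rw [uIcc_of_le hb.le]; constructor <;> linarith), hc 0 left_mem_uIcc]

theorem hasDerivWithinAt_integral [CompleteSpace F] {p : ℝ → F} (hp : ContinuousOn p (Ici 0))
    {x : ℝ} (hx : 0 ≤ x) : HasDerivWithinAt (fun t => ∫ s in (0 : ℝ)..t, p s) (p x) (Ici 0) x := by
  have hc : Continuous fun s : ℝ => p (max 0 s) :=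
    hp.comp_continuous (by fun_prop) fun s => le_max_left 0 s
  have h1 := (hc.integral_hasStrictDerivAt 0 x).hasDerivAt.hasDerivWithinAt (s := Ici 0)
  have h2 : ∀ t ∈ Ici (0 : ℝ), ∫ s in (0 : ℝ)..t, p s = ∫ s in (0 : ℝ)..t, p (max 0 s) := by
    intro t ht
    refine intervalIntegral.integral_congr fun s hs => ?_
    rw [uIcc_of_le ht] at hs
    simp only [max_eq_right hs.1]
  rw [max_eq_right hx] at h1
  exact h1.congr h2 (h2 x hx)

end Vector

/-! ### Solutions on the half line and their Wronskians -/

section Solutions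

variable {n : ℕ} {V : ℝ → Mat n} {k : ℂ} {ψ : ℝ → Mat n}

theorem hderiv_eq {ψ' : Mat n} {x : ℝ} (hx : 0 ≤ x) (h : HasDerivWithinAt ψ ψ' (Ici 0) x) :
    hderiv ψ x = ψ' :=
  h.derivWithin (uniqueDiffOn_Ici 0 x hx)

theorem InWeightedL1.integrableOn {ε : ℝ} (hε : 0 ≤ ε) (hV : InWeightedL1 ε V) :
    IntegrableOn V (Ioi 0) := by
  refine Integrable.mono' hV.2 hV.1 ?_
  filter_upwards [ae_restrict_mem measurableSet_Ioi] with x hx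
  have hx' : (0 : ℝ) < x := hx
  exact le_mul_of_one_le_left (norm_nonneg _) (Real.one_le_rpow (by linarith) hε)

theorem IsSolution.hasDerivWithinAt (h : IsSolution V k ψ) {x : ℝ} (hx : 0 ≤ x) :
    HasDerivWithinAt ψ (hderiv ψ x) (Ici 0) x :=
  (h.differentiableOn x hx).hasDerivWithinAt

theorem IsSolution.hasDerivAt (h : IsSolution V k ψ) {x : ℝ} (hx : 0 < x) :
    HasDerivAt ψ (hderiv ψ x) x :=
  (h.hasDerivWithinAt hx.le).hasDerivAt (Ici_mem_nhds hx)

theorem IsSolution.continuousOn (h : IsSolution V k ψ) : ContinuousOn ψ (Ici 0) :=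
  h.differentiableOn.continuousOn

theorem IsSolution.continuousOn_hderiv (h : IsSolution V k ψ) :
    ContinuousOn (hderiv ψ) (Ici 0) := by
  intro x hx
  have hx : 0 ≤ x := hx
  have hb : (0 : ℝ) < x + 1 := by linarith
  have h1 := (h.absolutelyContinuous (x + 1) hb).continuousOn
  rw [uIcc_of_le hb.le] at h1
  refine (h1 x ⟨hx, by linarith⟩).mono_of_mem_nhdsWithin ?_
  rw [← Ici_inter_Iic]
  exact inter_mem_nhdsWithin _ (Iic_mem_nhds (by linarith))

theorem IsSolution.absolutelyContinuous_self (h : IsSolution V k ψ) {b : ℝ} (hb : 0 < b) :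
    AbsolutelyContinuousOnInterval ψ 0 b :=
  absolutelyContinuousOnInterval_of_hasDerivWithinAt (fun _ hx => h.hasDerivWithinAt hx)
    h.continuousOn_hderiv hb

theorem IsSolution.congr {χ : ℝ → Mat n}
    (h : IsSolution V k ψ) (e : ∀ x, 0 ≤ x → χ x = ψ x) : IsSolution V k χ := by
  have e' : ∀ x, 0 ≤ x → hderiv χ x = hderiv ψ x := fun x hx => derivWithin_congr e (e x hx)
  refine ⟨h.differentiableOn.congr e, fun b hb => ?_, ?_⟩
  · refine absolutelyContinuousOnInterval_congr (h.absolutelyContinuous b hb) fun x hx => ?_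
    rw [uIcc_of_le hb.le] at hx
    exact (e' x hx.1).symm
  · filter_upwards [h.equation, ae_restrict_mem measurableSet_Ioi] with x h1 hx
    have hx : 0 < x := hx
    rw [e x hx.le]
    refine h1.congr_of_eventuallyEq ?_
    filter_upwards [Ioi_mem_nhds hx] with t ht using e' t (le_of_lt ht)

theorem IsSolution.hderiv_mul_right (h : IsSolution V k ψ) (M : Mat n) {x : ℝ} (hx : 0 ≤ x) :
    hderiv (fun t => ψ t * M) x = hderiv ψ x * M :=
  hderiv_eq hx ((h.hasDerivWithinAt hx).mul_const M)

/-- Solutions, as matrix functions, form a right module over the constant matrices. -/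
theorem IsSolution.mul_right (h : IsSolution V k ψ) (M : Mat n) :
    IsSolution V k (fun t => ψ t * M) where
  differentiableOn x hx := ((h.hasDerivWithinAt hx).mul_const M).differentiableWithinAt
  absolutelyContinuous b hb := by
    refine absolutelyContinuousOnInterval_congr
      (f := fun x => hderiv ψ x * (fun _ : ℝ => M) x)
      ((h.absolutelyContinuous b hb).ring_mul
        (absolutelyContinuousOnInterval_of_hasDerivWithinAt (f' := 0)
          (fun x _ => hasDerivWithinAt_const x _ M) continuousOn_const hb)) fun x hx => ?_
    rw [uIcc_of_le hb.le] at hx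
    exact (h.hderiv_mul_right M hx.1).symm
  equation := by
    filter_upwards [h.equation, ae_restrict_mem measurableSet_Ioi] with x h1 hx
    have hx : 0 < x := hx
    have h2 := h1.mul_const M
    rw [sub_mul, mul_assoc, smul_mul_assoc] at h2
    refine h2.congr_of_eventuallyEq ?_
    filter_upwards [Ioi_mem_nhds hx] with t ht using h.hderiv_mul_right M (le_of_lt ht)

theorem IsSolution.sub {χ : ℝ → Mat n} (h : IsSolution V k ψ) (h' : IsSolution V k χ) :
    IsSolution V k (fun t => ψ t - χ t) := by
  have e : ∀ x, 0 ≤ x → hderiv (fun t => ψ t - χ t) x = hderiv ψ x - hderiv χ x := fun x hx =>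
    hderiv_eq hx ((h.hasDerivWithinAt hx).sub (h'.hasDerivWithinAt hx))
  refine ⟨h.differentiableOn.sub h'.differentiableOn, fun b hb => ?_, ?_⟩
  · refine absolutelyContinuousOnInterval_congr
      ((h.absolutelyContinuous b hb).sub (h'.absolutelyContinuous b hb)) fun x hx => ?_
    rw [uIcc_of_le hb.le] at hx
    exact (e x hx.1).symm
  · filter_upwards [h.equation, h'.equation, ae_restrict_mem measurableSet_Ioi] with x h1 h2 hx
    have hx : 0 < x := hx
    have h3 := h1.sub h2
    have e2 : V x * ψ x - k ^ 2 • ψ x - (V x * χ x - k ^ 2 • χ x) =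
        V x * (ψ x - χ x) - k ^ 2 • (ψ x - χ x) := by
      rw [mul_sub, smul_sub]; abel
    rw [e2] at h3
    refine h3.congr_of_eventuallyEq ?_
    filter_upwards [Ioi_mem_nhds hx] with t ht using e t (le_of_lt ht)

theorem hasDerivWithinAt_conjTranspose {f : ℝ → Mat n} {f' : Mat n} {s : Set ℝ} {x : ℝ}
    (h : HasDerivWithinAt f f' s x) : HasDerivWithinAt (fun t => (f t)ᴴ) f'ᴴ s x :=
  h.star

theorem hasDerivAt_conjTranspose {f : ℝ → Mat n} {f' : Mat n} {x : ℝ}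
    (h : HasDerivAt f f' x) : HasDerivAt (fun t => (f t)ᴴ) f'ᴴ x :=
  h.star

theorem continuousOn_conjTranspose {f : ℝ → Mat n} {s : Set ℝ} (h : ContinuousOn f s) :
    ContinuousOn (fun t => (f t)ᴴ) s :=
  h.star

theorem norm_conjTranspose (M : Mat n) : ‖Mᴴ‖ = ‖M‖ :=
  norm_star M

/-- The Wronskian identity `[ψ†χ' - ψ'†χ]' = (k̄² - l²) ψ†χ` for solutions at energies `k²` and
`l²`, in integrated form. It holds because the potential is hermitian. -/
theorem IsSolution.wronskian {χ : ℝ → Mat n} {l : ℂ} (hVsa : ∀ x : ℝ, 0 < x → (V x)ᴴ = V x)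
    (h : IsSolution V k ψ) (h' : IsSolution V l χ) {x : ℝ} (hx : 0 ≤ x) :
    (ψ x)ᴴ * hderiv χ x - (hderiv ψ x)ᴴ * χ x =
      (ψ 0)ᴴ * hderiv χ 0 - (hderiv ψ 0)ᴴ * χ 0 +
        (star k ^ 2 - l ^ 2) • ∫ t in (0 : ℝ)..x, (ψ t)ᴴ * χ t := by
  have hp : ContinuousOn (fun t => (ψ t)ᴴ * χ t) (Ici 0) :=
    (continuousOn_conjTranspose h.continuousOn).mul h'.continuousOn
  have hI := fun {t : ℝ} (ht : 0 ≤ t) =>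
    (hasDerivWithinAt_integral hp ht).const_smul (star k ^ 2 - l ^ 2)
  have key := eq_zero_value_of_ae_hasDerivAt_zero
    (f := fun t => (ψ t)ᴴ * hderiv χ t - (hderiv ψ t)ᴴ * χ t -
      (star k ^ 2 - l ^ 2) • ∫ s in (0 : ℝ)..t, (ψ s)ᴴ * χ s)
    (fun b hb => ?_) ?_ hx
  · simp only [intervalIntegral.integral_same, smul_zero, sub_zero] at key
    rw [← key]; abel
  · exact (((h.absolutelyContinuous_self hb).star_fun.ring_mul (h'.absolutelyContinuous b hb)).sub
      ((h.absolutelyContinuous b hb).star_fun.ring_mul (h'.absolutelyContinuous_self hb))).sub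
      (absolutelyContinuousOnInterval_of_hasDerivWithinAt (fun t ht => hI ht)
        (hp.const_smul (star k ^ 2 - l ^ 2)) hb)
  · filter_upwards [h.equation, h'.equation, ae_restrict_mem measurableSet_Ioi] with t h1 h2 ht
    have ht : 0 < t := ht
    have h3 := (((hasDerivAt_conjTranspose (h.hasDerivAt ht)).mul h2).sub
      ((hasDerivAt_conjTranspose h1).mul (h'.hasDerivAt ht))).sub
      ((hI ht.le).hasDerivAt (Ici_mem_nhds ht))
    refine h3.congr_deriv ?_
    simp only [Matrix.conjTranspose_sub, Matrix.conjTranspose_mul, Matrix.conjTranspose_smul,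
      hVsa t ht, mul_sub, sub_mul, sub_smul, smul_mul_assoc, mul_smul_comm, mul_assoc, star_pow]
    abel

end Solutions

/-! ### Uniqueness -/

/-- Grönwall's inequality with an integrable kernel, run backwards from `b`. -/
theorem eq_zero_of_le_integral {y m : ℝ → ℝ} {b : ℝ} (hb : 0 ≤ b)
    (hy : ContinuousOn y (Icc 0 b)) (hy0 : ∀ x ∈ Icc 0 b, 0 ≤ y x) (hm0 : ∀ x, 0 ≤ m x)
    (hm : IntervalIntegrable m volume 0 b)
    (hle : ∀ x ∈ Icc 0 b, y x ≤ ∫ t in x..b, m t * y t) : ∀ x ∈ Icc 0 b, y x = 0 := by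
  intro x hx
  rw [← uIcc_of_le hb] at hy
  have hmy : IntervalIntegrable (fun t => m t * y t) volume 0 b := hm.mul_continuousOn hy
  set q : ℝ → ℝ := fun t => ∫ s in (0 : ℝ)..t, m s * y s with hq
  set M : ℝ → ℝ := fun t => ∫ s in (0 : ℝ)..t, m s with hM
  have hqac : AbsolutelyContinuousOnInterval q 0 b := absolutelyContinuousOnInterval_integral hmy
  have hMac : AbsolutelyContinuousOnInterval M 0 b := absolutelyContinuousOnInterval_integral hm
  -- The remaining integral, times the integrating factor, is nondecreasing and vanishes at `b`.
  set P : ℝ → ℝ := fun t => (q b - q t) * Real.exp (M t) with hP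
  have hY : ∀ t ∈ Icc 0 b, q b - q t = ∫ s in t..b, m s * y s := fun t ht =>
    intervalIntegral.integral_interval_sub_left hmy
      (hmy.mono_set (uIcc_subset_uIcc left_mem_uIcc (by rw [uIcc_of_le hb]; exact ht)))
  obtain ⟨c, hc⟩ := hMac.exists_bound
  have hexp : AbsolutelyContinuousOnInterval (fun t => Real.exp (M t)) 0 b := by
    refine AbsolutelyContinuousOnInterval.of_dist_le (Real.exp c) 0 hMac hMac fun s hs t ht => ?_
    have hs' : M s ∈ Icc (-c) c := abs_le.mp (hc s hs)
    have ht' : M t ∈ Icc (-c) c := abs_le.mp (hc t ht)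
    have := (convex_Icc (-c) c).norm_image_sub_le_of_norm_hasDerivWithin_le
      (f := Real.exp) (f' := Real.exp) (C := Real.exp c)
      (fun u _ => (Real.hasDerivAt_exp u).hasDerivWithinAt)
      (fun u hu => by
        rw [Real.norm_eq_abs, abs_of_pos (Real.exp_pos u)]
        exact Real.exp_le_exp.mpr hu.2) ht' hs'
    simpa [dist_eq_norm] using this
  have hPac : AbsolutelyContinuousOnInterval P 0 b := by
    refine AbsolutelyContinuousOnInterval.ring_mul ?_ hexp
    refine AbsolutelyContinuousOnInterval.of_dist_le 1 0 hqac hqac fun s _ t _ => ?_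
    rw [dist_sub_left]; simp
  have hPx : P x ≤ P b := by
    have hsub : uIcc x b ⊆ uIcc 0 b :=
      uIcc_subset_uIcc (by rw [uIcc_of_le hb]; exact hx) right_mem_uIcc
    have h1 := (hPac.mono hsub).integral_deriv_eq_sub
    have h2 : 0 ≤ ∫ t in x..b, deriv P t := by
      refine intervalIntegral.integral_nonneg_of_ae_restrict hx.2 ?_
      rw [EventuallyLE, ae_restrict_iff' measurableSet_Icc]
      filter_upwards [hmy.ae_hasDerivAt_integral, hm.ae_hasDerivAt_integral] with t h3 h4 ht
      have ht0 : t ∈ Icc 0 b := ⟨hx.1.trans ht.1, ht.2⟩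
      have ht' : t ∈ uIcc 0 b := by rw [uIcc_of_le hb]; exact ht0
      have h5 := ((h3 ht' 0 left_mem_uIcc).const_sub (q b)).mul (h4 ht' 0 left_mem_uIcc).exp
      have h6 : deriv P t = _ := h5.deriv
      rw [h6, Pi.zero_apply]
      have h7 := hle t ht0
      rw [← hY t ht0] at h7
      have h8 := mul_le_mul_of_nonneg_left h7 (mul_nonneg (Real.exp_pos (M t)).le (hm0 t))
      have h9 : Real.exp (M t) * m t * (q b - q t) - Real.exp (M t) * m t * y t =
        -(m t * y t) * Real.exp (M t) + (q b - q t) * (Real.exp (M t) * m t) := by ring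
      linarith
    linarith
  have hPb : P b = 0 := by simp [hP]
  have h1 : q b - q x ≤ 0 := by
    by_contra hlt
    push Not at hlt
    have : 0 < P x := mul_pos hlt (Real.exp_pos _)
    linarith
  have h2 := hle x hx
  rw [← hY x hx] at h2
  exact le_antisymm (h2.trans h1) (hy0 x hx)

/-- A solution with vanishing Cauchy data at `b` vanishes on `[0,b]`. -/
theorem IsSolution.eq_zero_of_le {n : ℕ} {V : ℝ → Mat n} {k : ℂ} {ψ : ℝ → Mat n}
    (hV : IntegrableOn V (Ioi 0)) (h : IsSolution V k ψ) {b : ℝ} (hb : 0 < b)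
    (h0 : ψ b = 0) (h1 : hderiv ψ b = 0) : ∀ x ∈ Icc 0 b, ψ x = 0 := by
  have hV' : IntervalIntegrable V volume 0 b :=
    (intervalIntegrable_iff_integrableOn_Ioc_of_le hb.le).mpr (hV.mono_set Ioc_subset_Ioi_self)
  have hIcc : uIcc 0 b ⊆ Ici (0 : ℝ) := by rw [uIcc_of_le hb.le]; exact Icc_subset_Ici_self
  have hc := h.continuousOn.mono hIcc
  have hc' := h.continuousOn_hderiv.mono hIcc
  have hq : IntervalIntegrable (fun t => V t * ψ t - k ^ 2 • ψ t) volume 0 b :=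
    (hV'.mul_continuousOn hc).sub (hc.const_smul (k ^ 2)).intervalIntegrable
  have hae : ∀ᵐ t : ℝ, t ∈ Ioi (0 : ℝ) → HasDerivAt (hderiv ψ) (V t * ψ t - k ^ 2 • ψ t) t :=
    (ae_restrict_iff' measurableSet_Ioi).mp h.equation
  have key := eq_zero_of_le_integral (y := fun t => ‖ψ t‖ + ‖hderiv ψ t‖)
    (m := fun t => 1 + ‖k ^ 2‖ + ‖V t‖) hb.le
    (by rw [← uIcc_of_le hb.le]; exact hc.norm.add hc'.norm) (fun _ _ => by positivity)
    (fun _ => by positivity) (intervalIntegrable_const.add hV'.norm) ?_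
  · intro x hx
    have := key x hx
    have h2 := norm_nonneg (hderiv ψ x)
    exact norm_le_zero_iff.mp (by linarith [norm_nonneg (ψ x)])
  intro x hx
  have hx' : x ∈ uIcc 0 b := by rw [uIcc_of_le hb.le]; exact hx
  have hsub : uIcc x b ⊆ uIcc 0 b := uIcc_subset_uIcc hx' right_mem_uIcc
  have e1 : ∫ t in x..b, hderiv ψ t = ψ b - ψ x :=
    integral_eq_sub_of_absolutelyContinuous ((h.absolutelyContinuous_self hb).mono hsub)
      (hc'.mono hsub).intervalIntegrable (by
        filter_upwards [Measure.ae_ne volume (0 : ℝ)] with t ht0 ht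
        exact h.hasDerivAt (lt_of_le_of_ne (hIcc (hsub ht)) (Ne.symm ht0)))
  have e2 : ∫ t in x..b, (V t * ψ t - k ^ 2 • ψ t) = hderiv ψ b - hderiv ψ x :=
    integral_eq_sub_of_absolutelyContinuous ((h.absolutelyContinuous b hb).mono hsub)
      (hq.mono_set hsub) (by
        filter_upwards [Measure.ae_ne volume (0 : ℝ), hae] with t ht0 h2 ht
        exact h2 (lt_of_le_of_ne (hIcc (hsub ht)) (Ne.symm ht0)))
  rw [h0, zero_sub] at e1
  rw [h1, zero_sub] at e2
  have n1 : ‖ψ x‖ ≤ ∫ t in x..b, ‖hderiv ψ t‖ := by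
    rw [← norm_neg, ← e1]; exact intervalIntegral.norm_integral_le_integral_norm hx.2
  have n2 : ‖hderiv ψ x‖ ≤ ∫ t in x..b, ‖V t * ψ t - k ^ 2 • ψ t‖ := by
    rw [← norm_neg, ← e2]; exact intervalIntegral.norm_integral_le_integral_norm hx.2
  refine (add_le_add n1 n2).trans ?_
  have i1 := (hc'.norm.mono hsub).intervalIntegrable (μ := volume)
  have i2 := (hq.mono_set hsub).norm
  rw [← intervalIntegral.integral_add i1 i2]
  refine intervalIntegral.integral_mono_on hx.2 (i1.add i2)
    (((intervalIntegrable_const.add hV'.norm).mul_continuousOn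
      (hc.norm.add hc'.norm)).mono_set hsub) fun t _ => ?_
  have n3 : ‖V t * ψ t - k ^ 2 • ψ t‖ ≤ ‖V t‖ * ‖ψ t‖ + ‖k ^ 2‖ * ‖ψ t‖ :=
    (norm_sub_le _ _).trans (add_le_add (norm_mul_le _ _) (norm_smul_le _ _))
  have := mul_nonneg (norm_nonneg (V t)) (norm_nonneg (hderiv ψ t))
  have := mul_nonneg (norm_nonneg (k ^ 2)) (norm_nonneg (hderiv ψ t))
  nlinarith [norm_nonneg (ψ t)]

/-! ### Decaying solutions at a negative energy -/

section Decay

variable {n : ℕ} {V : ℝ → Mat n} {κ : ℝ} {u : ℝ → Mat n}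

theorem exists_bound_of_tendsto {F : Type*} [NormedAddCommGroup F] {p : ℝ → F} {L : F}
    (hp : ContinuousOn p (Ici 0)) (hL : Tendsto p atTop (𝓝 L)) :
    ∃ G, 0 ≤ G ∧ ∀ x, 0 ≤ x → ‖p x‖ ≤ G := by
  have h1 : ∀ᶠ x in atTop, ‖p x‖ < ‖L‖ + 1 := hL.norm.eventually_lt_const (by linarith)
  obtain ⟨N, hN⟩ := eventually_atTop.mp h1
  obtain ⟨c, hc⟩ := (isCompact_Icc (a := (0 : ℝ)) (b := N)).exists_bound_of_continuousOn
    (hp.mono Icc_subset_Ici_self)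
  refine ⟨max c (‖L‖ + 1), le_max_of_le_right (by positivity), fun x hx => ?_⟩
  rcases le_total x N with h | h
  · exact le_max_of_le_left (hc x ⟨hx, h⟩)
  · exact le_max_of_le_right (hN x h).le

theorem I_mul_ofReal_sq (κ : ℝ) : (Complex.I * κ) ^ 2 = ((-κ ^ 2 : ℝ) : ℂ) := by
  rw [mul_pow, Complex.I_sq]; push_cast; ring

theorem hasDerivAt_exp_mul (c x : ℝ) :
    HasDerivAt (fun t => Real.exp (c * t)) (c * Real.exp (c * x)) x := by
  simpa [mul_comm] using ((hasDerivAt_id x).const_mul c).exp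

/-- If `p` is bounded and `p' = e^{cx} m` with `c > 0`, then a limit of `m` at infinity is zero. -/
theorem eq_zero_of_tendsto_of_hasDerivAt_exp_smul {F : Type*} [NormedAddCommGroup F]
    [NormedSpace ℝ F] {p m : ℝ → F} {L : F} {c G : ℝ} (hc : 0 < c)
    (hp : ∀ x, 0 < x → HasDerivAt p (Real.exp (c * x) • m x) x)
    (hG : ∀ x, 0 < x → ‖p x‖ ≤ G) (hm : Tendsto m atTop (𝓝 L)) : L = 0 := by
  refine SeparatingDual.eq_zero_of_forall_dual_eq_zero (R := ℝ) fun l => ?_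
  -- By the mean value theorem on `[x, x+1]`, `m` is small at some point beyond `x`, in the
  -- direction of each functional `l`.
  have hx : ∀ x : ℝ, ∃ y, x < y ∧ (0 < x → |l (m y)| ≤ 2 * ‖l‖ * G * Real.exp (-(c * x))) := by
    intro x
    by_cases h0 : 0 < x
    swap
    · exact ⟨x + 1, by linarith, fun h => absurd h h0⟩
    have hd : ∀ y, 0 < y → HasDerivAt (fun t => l (p t)) (l (Real.exp (c * y) • m y)) y :=
      fun y hy => l.hasFDerivAt.comp_hasDerivAt y (hp y hy)
    obtain ⟨y, hy, hyd⟩ := exists_hasDerivAt_eq_slope (fun t => l (p t))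
      (fun y => l (Real.exp (c * y) • m y)) (lt_add_one x)
      (fun y hy => (hd y (h0.trans_le hy.1)).continuousAt.continuousWithinAt)
      (fun y hy => hd y (h0.trans hy.1))
    refine ⟨y, hy.1, fun _ => ?_⟩
    simp only [map_smul, smul_eq_mul, add_sub_cancel_left, div_one] at hyd
    have b : ∀ y, 0 < y → |l (p y)| ≤ ‖l‖ * G := fun y hy =>
      (l.le_opNorm (p y)).trans (mul_le_mul_of_nonneg_left (hG y hy) (norm_nonneg _))
    have h1 : |Real.exp (c * y) * l (m y)| ≤ 2 * ‖l‖ * G := by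
      rw [hyd]
      have := abs_sub (l (p (x + 1))) (l (p x))
      linarith [b x h0, b (x + 1) (by linarith)]
    rw [abs_mul, abs_of_pos (Real.exp_pos _)] at h1
    have h2 : Real.exp (c * x) * |l (m y)| ≤ 2 * ‖l‖ * G :=
      (mul_le_mul_of_nonneg_right
        (Real.exp_le_exp.mpr (mul_le_mul_of_nonneg_left hy.1.le hc.le)) (abs_nonneg _)).trans h1
    rwa [Real.exp_neg, ← div_eq_mul_inv, le_div_iff₀ (Real.exp_pos _), mul_comm]
  choose y hy1 hy2 using hx
  have hy : Tendsto y atTop atTop := tendsto_atTop_mono (fun x => (hy1 x).le) tendsto_id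
  have t1 : Tendsto (fun x => l (m (y x))) atTop (𝓝 (l L)) :=
    ((l.continuous.tendsto L).comp hm).comp hy
  have t2 : Tendsto (fun x => l (m (y x))) atTop (𝓝 0) := by
    refine squeeze_zero_norm' (a := fun x => 2 * ‖l‖ * G * Real.exp (-(c * x))) ?_ ?_
    · filter_upwards [eventually_gt_atTop 0] with x hx using hy2 x hx
    · have : Tendsto (fun x : ℝ => Real.exp (-(c * x))) atTop (𝓝 0) :=
        Real.tendsto_exp_neg_atTop_nhds_zero.comp (tendsto_id.const_mul_atTop hc)
      simpa using this.const_mul (2 * ‖l‖ * G)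
  exact tendsto_nhds_unique t1 t2

/-- A solution of size `e^{-κx}` at energy `-κ²` satisfies the first order equation `u' = -κu` up to
an error controlled by the tail of the potential: the function `e^{-κx}(u' + κu)` has the integrable
derivative `e^{-κx}Vu`, and its limit vanishes because `e^{κx}u` would be unbounded otherwise. -/
theorem IsSolution.norm_hderiv_add_le (hκ : 0 < κ) (hV : IntegrableOn V (Ioi 0))
    (hu : IsSolution V (Complex.I * κ) u) {G : ℝ} (hG0 : 0 ≤ G)
    (hG : ∀ x, 0 ≤ x → ‖u x‖ ≤ G * Real.exp (-κ * x)) {x : ℝ} (hx : 0 ≤ x) :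
    ‖hderiv u x + κ • u x‖ ≤ G * Real.exp (-κ * x) * ∫ y in Ioi x, ‖V y‖ := by
  set m : ℝ → Mat n := fun t => Real.exp (-κ * t) • (hderiv u t + κ • u t) with hm
  set q : ℝ → Mat n := fun t => Real.exp (-κ * t) • (V t * u t) with hq
  have hqn : ∀ t, 0 ≤ t → ‖q t‖ ≤ G * Real.exp (-κ * t) ^ 2 * ‖V t‖ := by
    intro t ht
    rw [hq, norm_smul, Real.norm_eq_abs, abs_of_pos (Real.exp_pos _)]
    calc Real.exp (-κ * t) * ‖V t * u t‖
        ≤ Real.exp (-κ * t) * (‖V t‖ * (G * Real.exp (-κ * t))) := by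
          refine mul_le_mul_of_nonneg_left ?_ (Real.exp_pos _).le
          exact (norm_mul_le _ _).trans (mul_le_mul_of_nonneg_left (hG t ht) (norm_nonneg _))
      _ = _ := by ring
  have hexp1 : ∀ {s t : ℝ}, s ≤ t → Real.exp (-κ * t) ≤ Real.exp (-κ * s) := by
    intro s t hst
    exact Real.exp_le_exp.mpr (by nlinarith)
  have hqi : IntegrableOn q (Ioi 0) := by
    refine Integrable.mono' (hV.norm.const_mul G) ?_ ?_
    · have hexpc : Continuous fun t : ℝ => Real.exp (-κ * t) := by fun_prop
      refine hexpc.aestronglyMeasurable.smul ?_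
      exact hV.aestronglyMeasurable.mul
        ((hu.continuousOn.mono Ioi_subset_Ici_self).aestronglyMeasurable measurableSet_Ioi)
    · filter_upwards [ae_restrict_mem measurableSet_Ioi] with t ht
      have ht : 0 < t := ht
      refine (hqn t ht.le).trans (mul_le_mul_of_nonneg_right ?_ (norm_nonneg _))
      have h1 := hexp1 ht.le
      rw [mul_zero, Real.exp_zero] at h1
      exact mul_le_of_le_one_right hG0 (pow_le_one₀ (Real.exp_pos _).le h1)
  have hmac : ∀ b, 0 < b → AbsolutelyContinuousOnInterval m 0 b := fun b hb =>
    (absolutelyContinuousOnInterval_of_hasDerivWithinAt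
      (fun t _ => (hasDerivAt_exp_mul (-κ) t).hasDerivWithinAt) (by fun_prop) hb).smul
      ((hu.absolutelyContinuous b hb).add ((hu.absolutelyContinuous_self hb).const_smul κ))
  have hmd : ∀ᵐ t ∂volume.restrict (Ioi (0 : ℝ)), HasDerivAt m (q t) t := by
    filter_upwards [hu.equation, ae_restrict_mem measurableSet_Ioi] with t h1 ht
    have h2 := (hasDerivAt_exp_mul (-κ) t).smul (h1.add ((hu.hasDerivAt ht).const_smul κ))
    refine h2.congr_deriv ?_
    rw [I_mul_ofReal_sq, Complex.coe_smul]
    simp only [hq, smul_add, smul_sub, smul_smul, Pi.add_apply, Pi.smul_apply]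
    module
  have hmint : ∀ {s : ℝ}, 0 < s → ∫ t in (0 : ℝ)..s, q t = m s - m 0 := by
    intro s hs
    refine integral_eq_sub_of_absolutelyContinuous (hmac s hs)
      ((intervalIntegrable_iff_integrableOn_Ioc_of_le hs.le).mpr
        (hqi.mono_set Ioc_subset_Ioi_self)) ?_
    rw [ae_restrict_iff' measurableSet_Ioi] at hmd
    filter_upwards [hmd, Measure.ae_ne volume (0 : ℝ)] with t h1 h2 ht
    rw [uIcc_of_le hs.le] at ht
    exact h1 (lt_of_le_of_ne ht.1 (Ne.symm h2))
  have hlim : Tendsto m atTop (𝓝 (m 0 + ∫ t in Ioi 0, q t)) := by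
    refine ((intervalIntegral_tendsto_integral_Ioi 0 hqi tendsto_id).const_add (m 0)).congr' ?_
    filter_upwards [eventually_gt_atTop 0] with s hs
    rw [id, hmint hs]; abel
  -- The limit of `m` vanishes, since `(e^{κx} u)' = e^{2κx} m` and `e^{κx} u` is bounded.
  have hL : m 0 + ∫ t in Ioi 0, q t = 0 := by
    refine eq_zero_of_tendsto_of_hasDerivAt_exp_smul (p := fun t => Real.exp (κ * t) • u t)
      (c := 2 * κ) (G := G) (by linarith) (fun t ht => ?_) (fun t ht => ?_) hlim
    · refine ((hasDerivAt_exp_mul κ t).smul (hu.hasDerivAt ht)).congr_deriv ?_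
      have e : Real.exp (2 * κ * t) * Real.exp (-κ * t) = Real.exp (κ * t) := by
        rw [← Real.exp_add]; ring_nf
      rw [hm, smul_smul, e, smul_add, smul_smul, add_comm, mul_comm κ, add_comm]
    · rw [norm_smul, Real.norm_eq_abs, abs_of_pos (Real.exp_pos _)]
      refine (mul_le_mul_of_nonneg_left (hG t ht.le) (Real.exp_pos _).le).trans (le_of_eq ?_)
      rw [mul_left_comm, ← Real.exp_add]
      simp
  have hmx : m x = -∫ t in Ioi x, q t := by
    rcases hx.eq_or_lt with rfl | hx0
    · exact eq_neg_of_add_eq_zero_left hL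
    · have h1 := intervalIntegral.integral_interval_add_Ioi hqi
        (hqi.mono_set (Ioi_subset_Ioi hx0.le))
      rw [hmint hx0] at h1
      rw [← h1] at hL
      rw [eq_neg_iff_add_eq_zero, ← hL]; abel
  have hmn : ‖m x‖ ≤ G * Real.exp (-κ * x) ^ 2 * ∫ y in Ioi x, ‖V y‖ := by
    rw [hmx, norm_neg, ← integral_const_mul]
    refine norm_integral_le_of_norm_le
      ((hV.mono_set (Ioi_subset_Ioi hx)).norm.const_mul _) ?_
    filter_upwards [ae_restrict_mem measurableSet_Ioi] with t ht
    have ht : x < t := ht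
    refine (hqn t (hx.trans ht.le)).trans (mul_le_mul_of_nonneg_right ?_ (norm_nonneg _))
    exact mul_le_mul_of_nonneg_left
      (pow_le_pow_left₀ (Real.exp_pos _).le (hexp1 ht.le) 2) hG0
  rw [hm, norm_smul, Real.norm_eq_abs, abs_of_pos (Real.exp_pos _)] at hmn
  refine le_of_mul_le_mul_left (hmn.trans (le_of_eq ?_)) (Real.exp_pos (-κ * x))
  ring

theorem integral_Ioi_norm_nonneg (V : ℝ → Mat n) (x : ℝ) : 0 ≤ ∫ y in Ioi x, ‖V y‖ :=
  integral_nonneg fun _ => norm_nonneg _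

theorem integral_Ioi_norm_anti (hV : IntegrableOn V (Ioi 0)) {x y : ℝ} (hx : 0 ≤ x)
    (hxy : x ≤ y) : ∫ t in Ioi y, ‖V t‖ ≤ ∫ t in Ioi x, ‖V t‖ :=
  setIntegral_mono_set (hV.mono_set (Ioi_subset_Ioi hx)).norm
    (Eventually.of_forall fun _ => norm_nonneg _) (Ioi_subset_Ioi hxy).eventuallyLE

theorem tendsto_integral_Ioi_norm (hV : IntegrableOn V (Ioi 0)) :
    Tendsto (fun x => ∫ y in Ioi x, ‖V y‖) atTop (𝓝 0) := by
  have h1 := intervalIntegral_tendsto_integral_Ioi 0 hV.norm tendsto_id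
  have h2 := h1.const_sub (∫ y in Ioi 0, ‖V y‖)
  rw [sub_self] at h2
  refine h2.congr' ?_
  filter_upwards [eventually_ge_atTop 0] with x hx
  rw [id, ← intervalIntegral.integral_interval_add_Ioi hV.norm
    (hV.mono_set (Ioi_subset_Ioi hx)).norm]
  abel

end Decay

/-! ### The Jost solution at `iκ` -/

section Jost

variable {n : ℕ} {V : ℝ → Mat n} {κ : ℝ} {f : ℝ → Mat n}

theorem IsJostSolution.tendsto_exp_smul (hf : IsJostSolution V (Complex.I * κ) f) :
    Tendsto (fun x => Real.exp (κ * x) • f x) atTop (𝓝 1) := by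
  refine hf.asymptotics.congr fun x => ?_
  have e : -(Complex.I * (Complex.I * κ) * x) = ((κ * x : ℝ) : ℂ) := by
    rw [← mul_assoc, Complex.I_mul_I]; push_cast; ring
  rw [e, ← Complex.ofReal_exp, Complex.coe_smul]

theorem IsJostSolution.exists_norm_le (hf : IsJostSolution V (Complex.I * κ) f) :
    ∃ G, 0 ≤ G ∧ ∀ x, 0 ≤ x → ‖f x‖ ≤ G * Real.exp (-κ * x) := by
  have hexpc : ContinuousOn (fun t : ℝ => Real.exp (κ * t)) (Ici 0) := by fun_prop
  obtain ⟨G, hG0, hG⟩ := exists_bound_of_tendsto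
    (hexpc.smul hf.isSolution.continuousOn) hf.tendsto_exp_smul
  refine ⟨G, hG0, fun x hx => ?_⟩
  have h1 : ‖Real.exp (κ * x) • f x‖ ≤ G := hG x hx
  rw [norm_smul, Real.norm_eq_abs, abs_of_pos (Real.exp_pos _)] at h1
  rw [neg_mul, Real.exp_neg, ← div_eq_mul_inv, le_div_iff₀ (Real.exp_pos _), mul_comm]
  exact h1

theorem IsJostSolution.tendsto_exp_smul_hderiv (hκ : 0 < κ) (hV : IntegrableOn V (Ioi 0))
    (hf : IsJostSolution V (Complex.I * κ) f) :
    Tendsto (fun x => Real.exp (κ * x) • hderiv f x) atTop (𝓝 (-(κ • (1 : Mat n)))) := by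
  obtain ⟨G, hG0, hG⟩ := hf.exists_norm_le
  have h1 : Tendsto (fun x => Real.exp (κ * x) • (hderiv f x + κ • f x)) atTop (𝓝 0) := by
    refine squeeze_zero_norm' (a := fun x => G * ∫ y in Ioi x, ‖V y‖) ?_ ?_
    · filter_upwards [eventually_ge_atTop 0] with x hx
      rw [norm_smul, Real.norm_eq_abs, abs_of_pos (Real.exp_pos _)]
      refine (mul_le_mul_of_nonneg_left (hf.isSolution.norm_hderiv_add_le hκ hV hG0 hG hx)
        (Real.exp_pos _).le).trans (le_of_eq ?_)
      have e : Real.exp (κ * x) * Real.exp (-κ * x) = 1 := by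
        rw [← Real.exp_add]; simp
      calc _ = (Real.exp (κ * x) * Real.exp (-κ * x)) * (G * ∫ y in Ioi x, ‖V y‖) := by ring
        _ = _ := by rw [e, one_mul]
    · simpa using (tendsto_integral_Ioi_norm hV).const_mul G
  have h2 := h1.sub (hf.tendsto_exp_smul.const_smul κ)
  rw [zero_sub] at h2
  refine h2.congr fun x => ?_
  module

theorem star_I_mul_ofReal_sq_sub (κ : ℝ) :
    star (Complex.I * (κ : ℂ)) ^ 2 - (Complex.I * κ) ^ 2 = 0 := by
  simp [mul_pow]

/-- At a real energy, the Wronskian of two solutions is constant. -/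
theorem IsSolution.wronskian_eq {ψ χ : ℝ → Mat n} (hVsa : ∀ x : ℝ, 0 < x → (V x)ᴴ = V x)
    (h : IsSolution V (Complex.I * κ) ψ) (h' : IsSolution V (Complex.I * κ) χ) {x : ℝ}
    (hx : 0 ≤ x) : (ψ x)ᴴ * hderiv χ x - (hderiv ψ x)ᴴ * χ x =
      (ψ 0)ᴴ * hderiv χ 0 - (hderiv ψ 0)ᴴ * χ 0 := by
  rw [h.wronskian hVsa h' hx, star_I_mul_ofReal_sq_sub, zero_smul, add_zero]

theorem IsJostSolution.wronskian_self (hκ : 0 < κ) (hV : IntegrableOn V (Ioi 0))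
    (hVsa : ∀ x : ℝ, 0 < x → (V x)ᴴ = V x) (hf : IsJostSolution V (Complex.I * κ) f) {x : ℝ}
    (hx : 0 ≤ x) : (f x)ᴴ * hderiv f x = (hderiv f x)ᴴ * f x := by
  set w := (f 0)ᴴ * hderiv f 0 - (hderiv f 0)ᴴ * f 0 with hw
  have t0 := hf.tendsto_exp_smul
  have t1 := hf.tendsto_exp_smul_hderiv hκ hV
  have t2 : Tendsto (fun x => Real.exp (κ * x) ^ 2 • w) atTop (𝓝 0) := by
    have h1 := (t0.star.mul t1).sub (t1.star.mul t0)
    have e : star (1 : Mat n) * -(κ • (1 : Mat n)) - star (-(κ • (1 : Mat n))) * 1 = 0 := by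
      simp
    rw [e] at h1
    refine h1.congr' ?_
    filter_upwards [eventually_ge_atTop 0] with x hx
    rw [hw, ← hf.isSolution.wronskian_eq hVsa hf.isSolution hx]
    simp only [star_smul, star_trivial, smul_mul_smul_comm, Matrix.star_eq_conjTranspose, smul_sub,
      pow_two]
  have hw0 : w = 0 := by
    have h1 : Tendsto (fun _ : ℝ => ‖w‖) atTop (𝓝 0) := by
      refine squeeze_zero' (Eventually.of_forall fun _ => norm_nonneg _) ?_
        (tendsto_zero_iff_norm_tendsto_zero.mp t2)
      filter_upwards [eventually_ge_atTop 0] with x hx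
      rw [norm_smul, Real.norm_eq_abs, abs_of_nonneg (by positivity)]
      exact le_mul_of_one_le_left (norm_nonneg _)
        (one_le_pow₀ (Real.one_le_exp (mul_nonneg hκ.le hx)))
    exact norm_eq_zero.mp (tendsto_nhds_unique tendsto_const_nhds h1)
  have := hf.isSolution.wronskian_eq hVsa hf.isSolution hx
  rw [← hw, hw0] at this
  exact sub_eq_zero.mp this

theorem IsJostSolution.eventually_isUnit (hf : IsJostSolution V (Complex.I * κ) f) :
    ∀ᶠ x in atTop, IsUnit (f x) := by
  filter_upwards [hf.tendsto_exp_smul.eventually (Units.isOpen.mem_nhds isUnit_one)] with x hx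
  have h1 : IsUnit (Real.exp (-(κ * x)) • (1 : Mat n)) := by
    refine IsUnit.of_mul_eq_one (Real.exp (κ * x) • (1 : Mat n)) ?_
    rw [smul_mul_smul_comm, ← Real.exp_add]; simp
  have h2 := h1.mul hx
  rwa [smul_mul_smul_comm, ← Real.exp_add, one_mul, neg_add_cancel, Real.exp_zero, one_smul] at h2

/-- A solution whose Wronskian with the Jost solution vanishes is a multiple of it: wherever `f` is
invertible, `f⁻¹u` has derivative zero, and uniqueness propagates the identity to `[0,∞)`. -/
theorem IsJostSolution.eq_mul_of_wronskian (hκ : 0 < κ) (hV : IntegrableOn V (Ioi 0))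
    (hVsa : ∀ x : ℝ, 0 < x → (V x)ᴴ = V x) (hf : IsJostSolution V (Complex.I * κ) f)
    {u : ℝ → Mat n} (hu : IsSolution V (Complex.I * κ) u)
    (hw : (f 0)ᴴ * hderiv u 0 - (hderiv f 0)ᴴ * u 0 = 0) :
    ∃ K : Mat n, ∀ x, 0 ≤ x → u x = f x * K := by
  obtain ⟨N, hN⟩ := eventually_atTop.mp hf.eventually_isUnit
  set b := max N 1 with hb
  have hb0 : 0 < b := lt_of_lt_of_le one_pos (le_max_right _ _)
  have hU : ∀ x, b ≤ x → IsUnit (f x) := fun x hx => hN x ((le_max_left _ _).trans hx)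
  have hinv : ∀ x, b ≤ x → HasDerivAt (fun t => Ring.inverse (f t))
      (-(Ring.inverse (f x) * hderiv f x * Ring.inverse (f x))) x := by
    intro x hx
    obtain ⟨U, hU'⟩ := hU x hx
    have h1 := hasFDerivAt_ringInverse (𝕜 := ℝ) U
    rw [hU'] at h1
    have h2 := h1.comp_hasDerivAt x (hf.isSolution.hasDerivAt (hb0.trans_le hx))
    refine h2.congr_deriv ?_
    rw [← hU', Ring.inverse_unit]
    simp
  -- Both `f† f' = f'† f` and `f† u' = f'† u` hold, so `u' = f' f⁻¹ u`.
  have hd : ∀ x, b ≤ x → HasDerivAt (fun t => Ring.inverse (f t) * u t) 0 x := by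
    intro x hx
    have hx0 : 0 < x := hb0.trans_le hx
    refine ((hinv x hx).mul (hu.hasDerivAt hx0)).congr_deriv ?_
    have w1 := hf.wronskian_self hκ hV hVsa hx0.le
    have w2 := hf.isSolution.wronskian_eq hVsa hu hx0.le
    rw [hw, sub_eq_zero] at w2
    have c1 := Ring.mul_inverse_cancel (f x) (hU x hx)
    have hUs : IsUnit (f x)ᴴ := (hU x hx).star
    have e : hderiv f x * Ring.inverse (f x) * u x = hderiv u x := by
      refine hUs.mul_left_cancel ?_
      rw [← mul_assoc, ← mul_assoc, w1, mul_assoc _ (f x), c1, mul_one, w2]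
    calc -(Ring.inverse (f x) * hderiv f x * Ring.inverse (f x)) * u x +
          Ring.inverse (f x) * hderiv u x
        = Ring.inverse (f x) * (hderiv u x - hderiv f x * Ring.inverse (f x) * u x) := by
          noncomm_ring
      _ = 0 := by rw [e, sub_self, mul_zero]
  set K := Ring.inverse (f b) * u b with hK
  have hconst : ∀ x, b ≤ x → Ring.inverse (f x) * u x = K := by
    intro x hx
    exact (convex_Ici b).is_const_of_fderivWithin_eq_zero (𝕜 := ℝ)
      (f := fun t => Ring.inverse (f t) * u t)
      (fun y hy => (hd y hy).differentiableAt.differentiableWithinAt)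
      (fun y hy => by
        have := ((hd y hy).hasDerivWithinAt (s := Ici b)).hasFDerivWithinAt.fderivWithin
          (uniqueDiffOn_Ici b y hy)
        rw [this]; ext; simp) hx self_mem_Ici
  have hlarge : ∀ x, b ≤ x → u x = f x * K := by
    intro x hx
    rw [← hconst x hx, ← mul_assoc, Ring.mul_inverse_cancel _ (hU x hx), one_mul]
  refine ⟨K, fun x hx => ?_⟩
  rcases le_total b x with h | h
  · exact hlarge x h
  have hs := hu.sub (hf.isSolution.mul_right K)
  have h0 : ∀ t, b < t → u t - f t * K = 0 := fun t ht => by rw [hlarge t ht.le, sub_self]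
  have hc : 0 < b + 1 := by linarith
  have hd0 : hderiv (fun t => u t - f t * K) (b + 1) = 0 := by
    refine hderiv_eq hc.le (HasDerivAt.hasDerivWithinAt ?_)
    refine (hasDerivAt_const (b + 1) (0 : Mat n)).congr_of_eventuallyEq ?_
    filter_upwards [Ioi_mem_nhds (lt_add_one b)] with t ht using h0 t ht
  exact sub_eq_zero.mp (hs.eq_zero_of_le hV hc (h0 _ (lt_add_one b)) hd0 x ⟨hx, by linarith⟩)

end Jost

/-! ### Moore–Penrose inverses and the normalization matrix -/

section Algebra

variable {n : ℕ}

theorem IsMoorePenroseInverse.unique {M X Y : Mat n} (hX : IsMoorePenroseInverse M X)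
    (hY : IsMoorePenroseInverse M Y) : X = Y := by
  have e1 : M * X = M * Y := by
    calc M * X = (M * X)ᴴ := hX.isHermitian_mul.symm
      _ = (M * Y * M * X)ᴴ := by rw [hY.mul_mul_self]
      _ = (M * X)ᴴ * (M * Y)ᴴ := by rw [← Matrix.conjTranspose_mul]; simp only [mul_assoc]
      _ = M * X * M * Y := by
        rw [hX.isHermitian_mul, hY.isHermitian_mul]; simp only [mul_assoc]
      _ = M * Y := by rw [hX.mul_mul_self]
  have e2 : X * M = Y * M := by
    calc X * M = (X * M)ᴴ := hX.isHermitian_mul'.symm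
      _ = (X * (M * Y * M))ᴴ := by rw [hY.mul_mul_self]
      _ = (Y * M)ᴴ * (X * M)ᴴ := by rw [← Matrix.conjTranspose_mul]; simp only [mul_assoc]
      _ = Y * (M * X * M) := by
        rw [hX.isHermitian_mul', hY.isHermitian_mul']; simp only [mul_assoc]
      _ = Y * M := by rw [hX.mul_mul_self]
  calc X = X * M * X := hX.self_mul_mul.symm
    _ = Y * (M * X) := by rw [e2, mul_assoc]
    _ = Y := by rw [e1, ← mul_assoc, hY.self_mul_mul]

theorem moorePenroseInverse_eq {M X : Mat n} (hX : IsMoorePenroseInverse M X) :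
    moorePenroseInverse M = X :=
  (exists_isMoorePenroseInverse M).choose_spec.unique hX

/-- If `M` lives on the range of the projection `Q` and is injective there, then `M + (1 - Q)` is
invertible. -/
theorem isUnit_add_one_sub {M Q : Mat n} (hQQ : Q * Q = Q) (hQM : Q * M = M)
    (hinj : ∀ v : Fin n → ℂ, M *ᵥ v = 0 → Q *ᵥ v = v → v = 0) : IsUnit (M + (1 - Q)) := by
  rw [← Matrix.mulVec_injective_iff_isUnit]
  refine (injective_iff_map_eq_zero (Matrix.mulVecLin (M + (1 - Q)))).mpr fun v hv => ?_
  rw [Matrix.mulVecLin_apply] at hv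
  have h1 : M *ᵥ v = 0 := by
    have := congrArg (fun w => Q *ᵥ w) hv
    simp only [Matrix.mulVec_mulVec, mul_add, hQM, mul_sub, mul_one, hQQ, sub_self, add_zero,
      Matrix.mulVec_zero] at this
    exact this
  rw [Matrix.add_mulVec, h1, zero_add, Matrix.sub_mulVec, Matrix.one_mulVec, sub_eq_zero] at hv
  exact hinj v h1 hv.symm

/-- The Moore–Penrose inverse of a matrix that is invertible on the range of `Q` and vanishes on its
orthogonal complement. -/
theorem moorePenroseInverse_eq_inverse_mul {M Q : Mat n} (hQQ : Q * Q = Q) (hQ : Qᴴ = Q)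
    (hQM : Q * M = M) (hMQ : M * Q = M) (hU : IsUnit (M + (1 - Q))) :
    moorePenroseInverse M = Ring.inverse (M + (1 - Q)) * Q ∧
      Q * moorePenroseInverse M = moorePenroseInverse M ∧
      moorePenroseInverse M * M = Q ∧ M * moorePenroseInverse M = Q := by
  set S := M + (1 - Q) with hS
  set R := Ring.inverse S with hR
  have c1 : S * R = 1 := Ring.mul_inverse_cancel _ hU
  have c2 : R * S = 1 := Ring.inverse_mul_cancel _ hU
  have s1 : S * Q = M := by rw [hS, add_mul, sub_mul, one_mul, hQQ, sub_self, add_zero, hMQ]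
  have s2 : Q * S = M := by rw [hS, mul_add, mul_sub, mul_one, hQQ, sub_self, add_zero, hQM]
  have r1 : R * M = Q := by rw [← s1, ← mul_assoc, c2, one_mul]
  have r2 : M * R = Q := by rw [← s2, mul_assoc, c1, mul_one]
  have rq : Q * R = R * Q := by
    calc Q * R = R * (S * Q) * R := by rw [← mul_assoc R, c2, one_mul]
      _ = R * (Q * S) * R := by rw [s1, s2]
      _ = R * Q := by rw [mul_assoc, mul_assoc, c1, mul_one]
  have a1 : R * Q * M = Q := by rw [mul_assoc, hQM, r1]
  have a2 : M * (R * Q) = Q := by rw [← mul_assoc, r2, hQQ]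
  have e : moorePenroseInverse M = R * Q :=
    moorePenroseInverse_eq ⟨by rw [a2, hQM], by rw [a1, ← mul_assoc, rq, mul_assoc, hQQ],
      by rw [a2, hQ], by rw [a1, hQ]⟩
  rw [e]
  exact ⟨rfl, by rw [← mul_assoc, rq, mul_assoc, hQQ], a1, a2⟩

theorem moorePenroseInverse_conjTranspose {M : Mat n} (hM : Mᴴ = M) :
    (moorePenroseInverse M)ᴴ = moorePenroseInverse M := by
  have h := (exists_isMoorePenroseInverse M).choose_spec
  change IsMoorePenroseInverse M (moorePenroseInverse M) at h
  refine (moorePenroseInverse_eq ⟨?_, ?_, ?_, ?_⟩).symm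
  · simpa [hM, mul_assoc] using congrArg Matrix.conjTranspose h.mul_mul_self
  · simpa [hM, mul_assoc] using congrArg Matrix.conjTranspose h.self_mul_mul
  · have := h.isHermitian_mul'
    rw [Matrix.conjTranspose_mul, hM] at this
    rw [Matrix.conjTranspose_mul, Matrix.conjTranspose_conjTranspose, hM, this]
  · have := h.isHermitian_mul
    rw [Matrix.conjTranspose_mul, hM] at this
    rw [Matrix.conjTranspose_mul, Matrix.conjTranspose_conjTranspose, hM, this]

theorem kerProjection_mul_self (M : Mat n) :
    kerProjection M * kerProjection M = kerProjection M := by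
  rw [kerProjection, ← map_mul]
  congr 1
  exact Submodule.isIdempotentElem_starProjection _

theorem kerProjection_conjTranspose (M : Mat n) : (kerProjection M)ᴴ = kerProjection M := by
  rw [kerProjection, ← Matrix.star_eq_conjTranspose]
  refine ((Matrix.toEuclideanCLM (n := Fin n) (𝕜 := ℂ)).symm.map_star' _).symm.trans (congrArg _ ?_)
  exact isSelfAdjoint_starProjection _

theorem mul_kerProjection (M : Mat n) : M * kerProjection M = 0 := by
  refine (Matrix.toEuclideanCLM (n := Fin n) (𝕜 := ℂ)).injective ?_
  refine (map_mul (Matrix.toEuclideanCLM (n := Fin n) (𝕜 := ℂ)) _ _).trans ?_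
  rw [map_zero, kerProjection]
  refine (congrArg (_ * ·) (StarAlgEquiv.apply_symm_apply _ _)).trans ?_
  ext1 v
  have h := Submodule.starProjection_apply_mem (LinearMap.ker (Matrix.toEuclideanLin M)) v
  exact LinearMap.mem_ker.mp h

/-- The algebra of the normalization matrix `C = H^{-1/2} Q`, where `H = 1 - Q + G` and `G` is a
Gram matrix on the range of `Q`: the matrix `H` is positive and commutes with `Q`. -/
theorem sqrt_inv_mul_properties {Q G : Mat n} (hQQ : Q * Q = Q) (hQ : Qᴴ = Q) (hQG : Q * G = G)
    (hGQ : G * Q = G) (hG : G.PosSemidef) (hU : IsUnit (1 - Q + G)) :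
    let C := (CFC.sqrt (1 - Q + G))⁻¹ * Q
    Cᴴ = C ∧ Q * C = C ∧ C * Q = C ∧ C * G * C = Q ∧ ∃ S : Mat n, S * C = Q := by
  intro C
  set H := 1 - Q + G with hH
  set s := CFC.sqrt H with hs
  have hH0 : 0 ≤ H := by
    have h1 : (1 - Q).PosSemidef := by
      have e : 1 - Q = (1 - Q)ᴴ * (1 - Q) := by
        simp [mul_sub, sub_mul, hQQ, hQ]
      rw [e]
      exact Matrix.posSemidef_conjTranspose_mul_self _
    exact (h1.add hG).nonneg
  have hss : s * s = H := CFC.sqrt_mul_sqrt_self H hH0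
  have hsU : IsUnit s := (CFC.isUnit_sqrt_iff H hH0).mpr hU
  have hdet := (Matrix.isUnit_iff_isUnit_det s).mp hsU
  have hsa : sᴴ = s := (IsSelfAdjoint.of_nonneg (CFC.sqrt_nonneg H))
  have hcomm : Commute H Q := by
    change H * Q = Q * H
    rw [hH, add_mul, sub_mul, mul_add, mul_sub, hGQ, hQG, one_mul, mul_one]
  have hsQ : s * Q = Q * s := by
    rw [hs, CFC.sqrt_eq_cfc]
    exact hcomm.cfc_nnreal _
  have i1 : s * s⁻¹ = 1 := Matrix.mul_nonsing_inv s hdet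
  have i2 : s⁻¹ * s = 1 := Matrix.nonsing_inv_mul s hdet
  have hiQ : s⁻¹ * Q = Q * s⁻¹ := by
    calc s⁻¹ * Q = s⁻¹ * (Q * s) * s⁻¹ := by rw [mul_assoc, mul_assoc, i1, mul_one]
      _ = s⁻¹ * (s * Q) * s⁻¹ := by rw [hsQ]
      _ = Q * s⁻¹ := by rw [← mul_assoc, i2, one_mul]
  have hisa : (s⁻¹)ᴴ = s⁻¹ := by rw [Matrix.conjTranspose_nonsing_inv, hsa]
  have hHQ : H * Q = G := by rw [hH, add_mul, sub_mul, one_mul, hQQ, sub_self, zero_add, hGQ]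
  have hC1 : Q * C = C := by
    change Q * (s⁻¹ * Q) = s⁻¹ * Q
    rw [hiQ, ← mul_assoc, hQQ]
  refine ⟨?_, hC1, ?_, ?_, s, ?_⟩
  · change (s⁻¹ * Q)ᴴ = s⁻¹ * Q
    rw [Matrix.conjTranspose_mul, hQ, hisa, hiQ]
  · change s⁻¹ * Q * Q = s⁻¹ * Q
    rw [mul_assoc, hQQ]
  · change s⁻¹ * Q * G * (s⁻¹ * Q) = Q
    calc s⁻¹ * Q * G * (s⁻¹ * Q) = s⁻¹ * (Q * G) * (Q * s⁻¹) := by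
          rw [hiQ]; rw [← hiQ]; simp only [mul_assoc]
      _ = s⁻¹ * G * s⁻¹ := by rw [hQG, ← mul_assoc, mul_assoc _ G Q, hGQ]
      _ = s⁻¹ * (s * s * Q) * s⁻¹ := by rw [hss, hHQ]
      _ = s⁻¹ * s * (s * Q) * s⁻¹ := by simp only [mul_assoc]
      _ = Q := by rw [i2, one_mul, hsQ, mul_assoc, i1, mul_one]
  · change s * (s⁻¹ * Q) = Q
    rw [← mul_assoc, i1, one_mul]

end Algebra

/-! ### Gram integrals -/

section Gram

variable {n : ℕ}

theorem integral_conjTranspose {α : Type*} [MeasurableSpace α] (μ : Measure α) (F : α → Mat n) :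
    (∫ x, F x ∂μ)ᴴ = ∫ x, (F x)ᴴ ∂μ :=
  ((starL' ℝ : Mat n ≃L[ℝ] Mat n).integral_comp_comm F).symm

/-- `M ↦ v† M v` as a continuous linear functional. -/
noncomputable def quadraticForm (v : Fin n → ℂ) : Mat n →L[ℝ] ℂ :=
  LinearMap.toContinuousLinearMap
    { toFun := fun M => star v ⬝ᵥ (M *ᵥ v)
      map_add' := fun M N => by rw [Matrix.add_mulVec, dotProduct_add]
      map_smul' := fun c M => by
        rw [Matrix.smul_mulVec, dotProduct_smul, RingHom.id_apply] }

theorem quadraticForm_apply (v : Fin n → ℂ) (M : Mat n) :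
    quadraticForm v M = star v ⬝ᵥ (M *ᵥ v) := rfl

theorem quadraticForm_conjTranspose_mul_self (v : Fin n → ℂ) (M : Mat n) :
    quadraticForm v (Mᴴ * M) = star (M *ᵥ v) ⬝ᵥ (M *ᵥ v) := by
  rw [quadraticForm_apply, ← Matrix.mulVec_mulVec, Matrix.dotProduct_mulVec, Matrix.star_mulVec]

theorem posSemidef_integral_gram {α : Type*} [MeasurableSpace α] {μ : Measure α}
    {Ψ : α → Mat n} (hi : Integrable (fun x => (Ψ x)ᴴ * Ψ x) μ) :
    (∫ x, (Ψ x)ᴴ * Ψ x ∂μ).PosSemidef := by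
  refine Matrix.PosSemidef.of_dotProduct_mulVec_nonneg ?_ fun v => ?_
  · rw [Matrix.IsHermitian, integral_conjTranspose]
    simp only [Matrix.conjTranspose_mul, Matrix.conjTranspose_conjTranspose]
  · rw [← quadraticForm_apply, ← (quadraticForm v).integral_comp_comm hi]
    refine integral_nonneg fun x => ?_
    rw [quadraticForm_conjTranspose_mul_self]
    exact dotProduct_star_self_nonneg _

/-- The kernel of a Gram integral over a half line consists of the vectors annihilated by the
integrand at every point. -/
theorem mulVec_eq_zero_of_integral_gram {Ψ : ℝ → Mat n} {a : ℝ} (hc : ContinuousOn Ψ (Ioi a))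
    (hi : IntegrableOn (fun x => (Ψ x)ᴴ * Ψ x) (Ioi a)) {v : Fin n → ℂ}
    (hv : (∫ x in Ioi a, (Ψ x)ᴴ * Ψ x) *ᵥ v = 0) : ∀ x, a < x → Ψ x *ᵥ v = 0 := by
  have h0 : ∫ x in Ioi a, quadraticForm v ((Ψ x)ᴴ * Ψ x) = 0 := by
    rw [(quadraticForm v).integral_comp_comm hi, quadraticForm_apply, hv, dotProduct_zero]
  have hre : ∫ x in Ioi a, (quadraticForm v ((Ψ x)ᴴ * Ψ x)).re = 0 := by
    have h1 := Complex.reCLM.integral_comp_comm ((quadraticForm v).integrable_comp hi)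
    rw [h0] at h1
    simpa using h1
  have hnn : ∀ x, 0 ≤ (quadraticForm v ((Ψ x)ᴴ * Ψ x)).re := fun x => by
    rw [quadraticForm_conjTranspose_mul_self]
    exact (Complex.le_def.mp (dotProduct_star_self_nonneg _)).1
  have hcont : ContinuousOn (fun x => (quadraticForm v ((Ψ x)ᴴ * Ψ x)).re) (Ioi a) :=
    Complex.continuous_re.comp_continuousOn
      ((quadraticForm v).continuous.comp_continuousOn ((continuousOn_conjTranspose hc).mul hc))
  have hae := (setIntegral_eq_zero_iff_of_nonneg_ae (Eventually.of_forall fun x => hnn x)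
    (Complex.reCLM.integrable_comp ((quadraticForm v).integrable_comp hi))).mp hre
  have hEq := Measure.eqOn_open_of_ae_eq hae isOpen_Ioi hcont continuousOn_const
  intro x hx
  have h2 := hEq hx
  simp only [Pi.zero_apply] at h2
  rw [quadraticForm_conjTranspose_mul_self] at h2
  have h3 := Complex.le_def.mp (dotProduct_star_self_nonneg (Ψ x *ᵥ v))
  exact dotProduct_star_self_eq_zero.mp (Complex.ext h2 h3.2.symm)

end Gram

/-! ### The Darboux transformation -/

/-- The data of a Darboux transformation: a solution `Φ` at energy `-κ²` that has vanishing
Wronskian with itself, and a hermitian matrix function `P` solving the Riccati equation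
`P' = P Φ†Φ P`, as a generalized inverse of the tail Gram matrix `∫_x^∞ Φ†Φ` does. -/
structure IsDarbouxData {n : ℕ} (V : ℝ → Mat n) (κ : ℝ) (Φ P : ℝ → Mat n) : Prop where
  selfadjoint : ∀ x : ℝ, 0 < x → (V x)ᴴ = V x
  isSolution : IsSolution V (Complex.I * κ) Φ
  wronskian : ∀ x : ℝ, 0 ≤ x → (Φ x)ᴴ * hderiv Φ x = (hderiv Φ x)ᴴ * Φ x
  riccati : ∀ x : ℝ, 0 ≤ x → HasDerivWithinAt P (P x * ((Φ x)ᴴ * Φ x) * P x) (Ici 0) x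
  hermitian : ∀ x : ℝ, 0 ≤ x → (P x)ᴴ = P x

/-- The derivative of `Φ P`. -/
noncomputable def darbouxFactorDeriv {n : ℕ} (Φ P : ℝ → Mat n) (x : ℝ) : Mat n :=
  hderiv Φ x * P x + Φ x * P x * (Φ x)ᴴ * (Φ x * P x)

/-- The derivative of `Φ P Φ†`. -/
noncomputable def darbouxDiagDeriv {n : ℕ} (Φ P : ℝ → Mat n) (x : ℝ) : Mat n :=
  darbouxFactorDeriv Φ P x * (Φ x)ᴴ + Φ x * P x * (hderiv Φ x)ᴴ

/-- The transform `φ + Φ P ∫_0^x Φ†φ` of a solution. -/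
noncomputable def darbouxTransform {n : ℕ} (Φ P φ : ℝ → Mat n) (x : ℝ) : Mat n :=
  φ x + Φ x * P x * ∫ y in (0 : ℝ)..x, (Φ y)ᴴ * φ y

/-- The derivative of the transform of a solution. -/
noncomputable def darbouxTransformDeriv {n : ℕ} (Φ P φ : ℝ → Mat n) (x : ℝ) : Mat n :=
  hderiv φ x + darbouxFactorDeriv Φ P x * (∫ y in (0 : ℝ)..x, (Φ y)ᴴ * φ y) +
    Φ x * P x * (Φ x)ᴴ * φ x

section Darboux

variable {n : ℕ} {V : ℝ → Mat n} {κ : ℝ} {Φ P : ℝ → Mat n}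

theorem IsDarbouxData.hasDerivWithinAt_factor (h : IsDarbouxData V κ Φ P) {x : ℝ} (hx : 0 ≤ x) :
    HasDerivWithinAt (fun t => Φ t * P t) (darbouxFactorDeriv Φ P x) (Ici 0) x := by
  refine ((h.isSolution.hasDerivWithinAt hx).mul (h.riccati x hx)).congr_deriv ?_
  simp only [darbouxFactorDeriv, mul_assoc]

theorem IsDarbouxData.hasDerivWithinAt_diag (h : IsDarbouxData V κ Φ P) {x : ℝ} (hx : 0 ≤ x) :
    HasDerivWithinAt (fun t => Φ t * P t * (Φ t)ᴴ) (darbouxDiagDeriv Φ P x) (Ici 0) x :=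
  (h.hasDerivWithinAt_factor hx).mul
    (hasDerivWithinAt_conjTranspose (h.isSolution.hasDerivWithinAt hx))

theorem IsDarbouxData.hasDerivAt_diag (h : IsDarbouxData V κ Φ P) {x : ℝ} (hx : 0 < x) :
    HasDerivAt (fun t => Φ t * P t * (Φ t)ᴴ) (darbouxDiagDeriv Φ P x) x :=
  (h.hasDerivWithinAt_diag hx.le).hasDerivAt (Ici_mem_nhds hx)

theorem IsDarbouxData.continuousOn_factor (h : IsDarbouxData V κ Φ P) :
    ContinuousOn (fun t => Φ t * P t) (Ici 0) :=
  fun _ hx => (h.hasDerivWithinAt_factor hx).continuousWithinAt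

theorem IsDarbouxData.continuousOn_diag (h : IsDarbouxData V κ Φ P) :
    ContinuousOn (fun t => Φ t * P t * (Φ t)ᴴ) (Ici 0) :=
  fun _ hx => (h.hasDerivWithinAt_diag hx).continuousWithinAt

theorem IsDarbouxData.continuousOn_factorDeriv (h : IsDarbouxData V κ Φ P) :
    ContinuousOn (darbouxFactorDeriv Φ P) (Ici 0) :=
  (h.isSolution.continuousOn_hderiv.mul
    (fun x hx => (h.riccati x hx).continuousWithinAt)).add
    (h.continuousOn_diag.mul h.continuousOn_factor)

theorem IsDarbouxData.continuousOn_diagDeriv (h : IsDarbouxData V κ Φ P) :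
    ContinuousOn (darbouxDiagDeriv Φ P) (Ici 0) :=
  (h.continuousOn_factorDeriv.mul (continuousOn_conjTranspose h.isSolution.continuousOn)).add
    (h.continuousOn_factor.mul (continuousOn_conjTranspose h.isSolution.continuousOn_hderiv))

theorem IsDarbouxData.diagDeriv_conjTranspose (h : IsDarbouxData V κ Φ P) {x : ℝ} (hx : 0 ≤ x) :
    (darbouxDiagDeriv Φ P x)ᴴ = darbouxDiagDeriv Φ P x := by
  simp only [darbouxDiagDeriv, darbouxFactorDeriv, Matrix.conjTranspose_add, add_mul,
    Matrix.conjTranspose_mul, Matrix.conjTranspose_conjTranspose, h.hermitian x hx, mul_assoc]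
  abel

/-- `Φ P` is a solution, at energy `-κ²`, for the transformed potential. -/
theorem IsDarbouxData.hasDerivAt_factorDeriv (h : IsDarbouxData V κ Φ P) {x : ℝ} (hx : 0 < x)
    (hΦ : HasDerivAt (hderiv Φ) (V x * Φ x - (Complex.I * κ) ^ 2 • Φ x) x) :
    HasDerivAt (darbouxFactorDeriv Φ P)
      ((V x + (2 : ℝ) • darbouxDiagDeriv Φ P x) * (Φ x * P x) -
        (Complex.I * κ) ^ 2 • (Φ x * P x)) x := by
  have h1 := (hΦ.mul ((h.riccati x hx.le).hasDerivAt (Ici_mem_nhds hx))).add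
    ((h.hasDerivAt_diag hx).mul ((h.hasDerivWithinAt_factor hx.le).hasDerivAt (Ici_mem_nhds hx)))
  refine h1.congr_deriv ?_
  have w : ∀ Z, (Φ x)ᴴ * (hderiv Φ x * Z) = (hderiv Φ x)ᴴ * (Φ x * Z) := fun Z => by
    rw [← mul_assoc, h.wronskian x hx.le, mul_assoc]
  have e : hderiv Φ x * (P x * ((Φ x)ᴴ * Φ x) * P x) +
      Φ x * P x * (Φ x)ᴴ * darbouxFactorDeriv Φ P x = darbouxDiagDeriv Φ P x * (Φ x * P x) := by
    simp only [darbouxDiagDeriv, darbouxFactorDeriv, add_mul, mul_add, mul_assoc, w]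
    abel
  calc (V x * Φ x - (Complex.I * κ) ^ 2 • Φ x) * P x +
        hderiv Φ x * (P x * ((Φ x)ᴴ * Φ x) * P x) +
        (darbouxDiagDeriv Φ P x * (Φ x * P x) + Φ x * P x * (Φ x)ᴴ * darbouxFactorDeriv Φ P x)
      = (V x * Φ x - (Complex.I * κ) ^ 2 • Φ x) * P x + darbouxDiagDeriv Φ P x * (Φ x * P x) +
        (hderiv Φ x * (P x * ((Φ x)ᴴ * Φ x) * P x) +
          Φ x * P x * (Φ x)ᴴ * darbouxFactorDeriv Φ P x) := by abel
    _ = _ := by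
      rw [e, two_smul, add_mul, add_mul, sub_mul, smul_mul_assoc, mul_assoc]
      abel

variable {k : ℂ} {φ : ℝ → Mat n}

theorem IsDarbouxData.continuousOn_integrand (h : IsDarbouxData V κ Φ P)
    (hφ : IsSolution V k φ) : ContinuousOn (fun y => (Φ y)ᴴ * φ y) (Ici 0) :=
  (continuousOn_conjTranspose h.isSolution.continuousOn).mul hφ.continuousOn

theorem IsDarbouxData.hasDerivWithinAt_transform (h : IsDarbouxData V κ Φ P)
    (hφ : IsSolution V k φ) {x : ℝ} (hx : 0 ≤ x) :
    HasDerivWithinAt (darbouxTransform Φ P φ) (darbouxTransformDeriv Φ P φ x) (Ici 0) x := by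
  refine ((hφ.hasDerivWithinAt hx).add ((h.hasDerivWithinAt_factor hx).mul
    (hasDerivWithinAt_integral (h.continuousOn_integrand hφ) hx))).congr_deriv ?_
  simp only [darbouxTransformDeriv, mul_assoc]
  abel

theorem IsDarbouxData.hderiv_transform (h : IsDarbouxData V κ Φ P)
    (hφ : IsSolution V k φ) {x : ℝ} (hx : 0 ≤ x) :
    hderiv (darbouxTransform Φ P φ) x = darbouxTransformDeriv Φ P φ x :=
  hderiv_eq hx (h.hasDerivWithinAt_transform hφ hx)

/-- The integral in the transform is a Wronskian, provided the Wronskian vanishes at the origin. -/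
theorem IsDarbouxData.wronskian_eq_integral (h : IsDarbouxData V κ Φ P) (hφ : IsSolution V k φ)
    (h0 : (Φ 0)ᴴ * hderiv φ 0 - (hderiv Φ 0)ᴴ * φ 0 = 0) {x : ℝ} (hx : 0 ≤ x) :
    (Φ x)ᴴ * hderiv φ x - (hderiv Φ x)ᴴ * φ x =
      ((Complex.I * κ) ^ 2 - k ^ 2) • ∫ y in (0 : ℝ)..x, (Φ y)ᴴ * φ y := by
  rw [h.isSolution.wronskian h.selfadjoint hφ hx, h0, zero_add]
  congr 2
  exact sub_eq_zero.mp (star_I_mul_ofReal_sq_sub κ)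

/-- The Darboux transform of a solution solves the equation with potential `V + 2 (Φ P Φ†)'`. -/
theorem IsDarbouxData.isSolution_transform (h : IsDarbouxData V κ Φ P) (hφ : IsSolution V k φ)
    (h0 : (Φ 0)ᴴ * hderiv φ 0 - (hderiv Φ 0)ᴴ * φ 0 = 0) {Vt : ℝ → Mat n}
    (hVt : ∀ x, 0 < x → Vt x = V x + (2 : ℝ) • darbouxDiagDeriv Φ P x) :
    IsSolution Vt k (darbouxTransform Φ P φ) := by
  have hint := h.continuousOn_integrand hφ
  refine ⟨fun x hx => (h.hasDerivWithinAt_transform hφ hx).differentiableWithinAt,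
    fun b hb => ?_, ?_⟩
  · have hI : AbsolutelyContinuousOnInterval (fun x => ∫ y in (0 : ℝ)..x, (Φ y)ᴴ * φ y) 0 b :=
      absolutelyContinuousOnInterval_of_hasDerivWithinAt
        (fun t ht => hasDerivWithinAt_integral hint ht) hint hb
    have hE := absolutelyContinuousOnInterval_of_hasDerivWithinAt
      (fun t ht => h.hasDerivWithinAt_diag ht) h.continuousOn_diagDeriv hb
    have hP : AbsolutelyContinuousOnInterval P 0 b := by
      have hPc : ContinuousOn P (Ici 0) := fun x hx => (h.riccati x hx).continuousWithinAt
      exact absolutelyContinuousOnInterval_of_hasDerivWithinAt h.riccati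
        ((hPc.mul ((continuousOn_conjTranspose h.isSolution.continuousOn).mul
          h.isSolution.continuousOn)).mul hPc) hb
    have hΨ := absolutelyContinuousOnInterval_of_hasDerivWithinAt
      (fun t ht => h.hasDerivWithinAt_factor ht) h.continuousOn_factorDeriv hb
    have hΨ1 := ((h.isSolution.absolutelyContinuous b hb).ring_mul hP).add (hE.ring_mul hΨ)
    refine absolutelyContinuousOnInterval_congr
      (((hφ.absolutelyContinuous b hb).add (hΨ1.ring_mul hI)).add
        (hE.ring_mul (hφ.absolutelyContinuous_self hb))) fun x hx => ?_
    rw [uIcc_of_le hb.le] at hx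
    exact (h.hderiv_transform hφ hx.1).symm
  · filter_upwards [hφ.equation, h.isSolution.equation, ae_restrict_mem measurableSet_Ioi]
      with x h1 h2 hx
    have hx : 0 < x := hx
    have h3 := (h1.add ((h.hasDerivAt_factorDeriv hx h2).mul
      ((hasDerivWithinAt_integral hint hx.le).hasDerivAt (Ici_mem_nhds hx)))).add
      ((h.hasDerivAt_diag hx).mul (hφ.hasDerivAt hx))
    have h4 : hderiv (darbouxTransform Φ P φ) =ᶠ[𝓝 x] darbouxTransformDeriv Φ P φ := by
      filter_upwards [Ioi_mem_nhds hx] with t ht using h.hderiv_transform hφ (le_of_lt ht)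
    refine (h3.congr_of_eventuallyEq h4).congr_deriv ?_
    have hW := h.wronskian_eq_integral hφ h0 hx.le
    rw [hVt x hx]
    simp only [darbouxTransform]
    set D := ∫ y in (0 : ℝ)..x, (Φ y)ᴴ * φ y with hD
    have e1 : Φ x * P x * (Φ x)ᴴ * hderiv φ x = Φ x * P x * (hderiv Φ x)ᴴ * φ x +
        (Complex.I * κ) ^ 2 • (Φ x * P x * D) - k ^ 2 • (Φ x * P x * D) := by
      rw [mul_assoc _ (Φ x)ᴴ, sub_eq_iff_eq_add.mp hW, mul_add, mul_smul_comm, sub_smul,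
        ← mul_assoc _ (hderiv Φ x)ᴴ]
      abel
    have e2 : darbouxFactorDeriv Φ P x * ((Φ x)ᴴ * φ x) + Φ x * P x * (hderiv Φ x)ᴴ * φ x =
        darbouxDiagDeriv Φ P x * φ x := by
      rw [darbouxDiagDeriv, add_mul, mul_assoc (darbouxFactorDeriv Φ P x)]
    have e3 : (V x + (2 : ℝ) • darbouxDiagDeriv Φ P x) * φ x =
        V x * φ x + (darbouxDiagDeriv Φ P x * φ x + darbouxDiagDeriv Φ P x * φ x) := by
      rw [two_smul, add_mul, add_mul]
    generalize V x + (2 : ℝ) • darbouxDiagDeriv Φ P x = U at e3 ⊢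
    rw [mul_add U, e3, sub_mul, smul_mul_assoc, smul_add, mul_assoc U (Φ x * P x) D, e1, ← e2]
    abel

end Darboux

/-! ### Bound states and their tail Gram matrices -/

/-- `Φ = f K` is a multiple of the Jost solution `f` at `iκ`, by a constant matrix `K` whose kernel
is that of the orthogonal projection `Q`. -/
structure IsBoundState {n : ℕ} (V : ℝ → Mat n) (κ : ℝ) (f Φ : ℝ → Mat n) (K Q : Mat n) : Prop where
  pos : 0 < κ
  integrable : IntegrableOn V (Ioi 0)
  selfadjoint : ∀ x : ℝ, 0 < x → (V x)ᴴ = V x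
  jost : IsJostSolution V (Complex.I * κ) f
  isSolution : IsSolution V (Complex.I * κ) Φ
  eq_mul : ∀ x, 0 ≤ x → Φ x = f x * K
  mul_proj : K * Q = K
  proj_mul_self : Q * Q = Q
  proj_conjTranspose : Qᴴ = Q
  injective : ∀ v : Fin n → ℂ, K *ᵥ v = 0 → Q *ᵥ v = v → v = 0

section BoundState

variable {n : ℕ} {V : ℝ → Mat n} {κ : ℝ} {f Φ : ℝ → Mat n} {K Q : Mat n}

theorem IsBoundState.exists_norm_le (h : IsBoundState V κ f Φ K Q) :
    ∃ G, 0 ≤ G ∧ ∀ x, 0 ≤ x → ‖Φ x‖ ≤ G * Real.exp (-κ * x) := by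
  obtain ⟨G, hG0, hG⟩ := h.jost.exists_norm_le
  refine ⟨G * ‖K‖, by positivity, fun x hx => ?_⟩
  rw [h.eq_mul x hx]
  refine (norm_mul_le _ _).trans ?_
  rw [mul_right_comm]
  exact mul_le_mul_of_nonneg_right (hG x hx) (norm_nonneg _)

theorem exp_neg_mul_sq (κ x : ℝ) : Real.exp (-κ * x) ^ 2 = Real.exp (-(2 * κ) * x) := by
  rw [← Real.exp_nat_mul]; push_cast; ring_nf

theorem norm_conjTranspose_mul_le {M N : Mat n} {a b : ℝ} (ha : ‖M‖ ≤ a) (hb : ‖N‖ ≤ b) :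
    ‖Mᴴ * N‖ ≤ a * b := by
  refine (norm_mul_le _ _).trans ?_
  rw [norm_conjTranspose]
  exact mul_le_mul ha hb (norm_nonneg _) ((norm_nonneg _).trans ha)

theorem IsBoundState.continuousOn_gram (h : IsBoundState V κ f Φ K Q) :
    ContinuousOn (fun x => (Φ x)ᴴ * Φ x) (Ici 0) :=
  (continuousOn_conjTranspose h.isSolution.continuousOn).mul h.isSolution.continuousOn

theorem integrableOn_of_norm_le_exp {F : Type*} [NormedAddCommGroup F] {g : ℝ → F} {c κ : ℝ}
    (hκ : 0 < κ) (hg : ContinuousOn g (Ici 0))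
    (hle : ∀ x, 0 ≤ x → ‖g x‖ ≤ c * Real.exp (-κ * x) ^ 2) : IntegrableOn g (Ioi 0) := by
  have h2 : -(2 * κ) < 0 := by linarith
  refine Integrable.mono' ((integrableOn_exp_mul_Ioi h2 0).const_mul c)
    ((hg.mono Ioi_subset_Ici_self).aestronglyMeasurable measurableSet_Ioi) ?_
  filter_upwards [ae_restrict_mem measurableSet_Ioi] with x hx
  rw [← exp_neg_mul_sq]
  exact hle x (le_of_lt hx)

theorem IsBoundState.integrableOn_gram (h : IsBoundState V κ f Φ K Q) :
    IntegrableOn (fun x => (Φ x)ᴴ * Φ x) (Ioi 0) := by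
  obtain ⟨G, hG0, hG⟩ := h.exists_norm_le
  refine integrableOn_of_norm_le_exp (c := G * G) h.pos h.continuousOn_gram fun x hx => ?_
  refine (norm_conjTranspose_mul_le (hG x hx) (hG x hx)).trans (le_of_eq ?_)
  ring

theorem IsBoundState.integrableOn_gram_Ioi (h : IsBoundState V κ f Φ K Q) {x : ℝ} (hx : 0 ≤ x) :
    IntegrableOn (fun t => (Φ t)ᴴ * Φ t) (Ioi x) :=
  h.integrableOn_gram.mono_set (Ioi_subset_Ioi hx)

theorem IsBoundState.mul_proj_right (h : IsBoundState V κ f Φ K Q) {x : ℝ} (hx : 0 ≤ x) :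
    Φ x * Q = Φ x := by
  rw [h.eq_mul x hx, mul_assoc, h.mul_proj]

theorem IsBoundState.proj_mul_conjTranspose (h : IsBoundState V κ f Φ K Q) {x : ℝ} (hx : 0 ≤ x) :
    Q * (Φ x)ᴴ = (Φ x)ᴴ := by
  have := congrArg Matrix.conjTranspose (h.mul_proj_right hx)
  rwa [Matrix.conjTranspose_mul, h.proj_conjTranspose] at this

theorem tailGram_conjTranspose (Φ : ℝ → Mat n) (x : ℝ) : (tailGram Φ x)ᴴ = tailGram Φ x := by
  rw [tailGram, integral_conjTranspose]
  simp only [Matrix.conjTranspose_mul, Matrix.conjTranspose_conjTranspose]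

theorem IsBoundState.tailGram_mul_proj (h : IsBoundState V κ f Φ K Q) {x : ℝ} (hx : 0 ≤ x) :
    tailGram Φ x * Q = tailGram Φ x := by
  rw [tailGram, ← integral_mul_const_of_integrable (h.integrableOn_gram_Ioi hx)]
  refine setIntegral_congr_fun measurableSet_Ioi fun t ht => ?_
  have ht : x < t := ht
  simp only [mul_assoc, h.mul_proj_right (hx.trans ht.le)]

theorem IsBoundState.proj_mul_tailGram (h : IsBoundState V κ f Φ K Q) {x : ℝ} (hx : 0 ≤ x) :
    Q * tailGram Φ x = tailGram Φ x := by
  have := congrArg Matrix.conjTranspose (h.tailGram_mul_proj hx)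
  rwa [Matrix.conjTranspose_mul, h.proj_conjTranspose, tailGram_conjTranspose] at this

/-- The tail Gram matrix is injective on the range of `Q`, because the Jost solution is invertible
far out. -/
theorem IsBoundState.isUnit_tailGram (h : IsBoundState V κ f Φ K Q) {x : ℝ} (hx : 0 ≤ x) :
    IsUnit (tailGram Φ x + (1 - Q)) := by
  refine isUnit_add_one_sub h.proj_mul_self (h.proj_mul_tailGram hx) fun v hv hQv => ?_
  have hsub : Ioi x ⊆ Ici 0 := fun t ht => hx.trans (le_of_lt ht)
  have h1 := mulVec_eq_zero_of_integral_gram (h.isSolution.continuousOn.mono hsub)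
    (h.integrableOn_gram_Ioi hx) hv
  obtain ⟨t, ht1, ht2⟩ := (h.jost.eventually_isUnit.and (eventually_gt_atTop x)).exists
  have h2 := h1 t ht2
  rw [h.eq_mul t (hx.trans ht2.le), ← Matrix.mulVec_mulVec] at h2
  exact h.injective v (Matrix.mulVec_injective_of_isUnit ht1 (by rw [h2, Matrix.mulVec_zero])) hQv

theorem IsBoundState.moorePenroseInverse_tailGram (h : IsBoundState V κ f Φ K Q) {x : ℝ}
    (hx : 0 ≤ x) :
    moorePenroseInverse (tailGram Φ x) = Ring.inverse (tailGram Φ x + (1 - Q)) * Q ∧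
      Q * moorePenroseInverse (tailGram Φ x) = moorePenroseInverse (tailGram Φ x) ∧
      moorePenroseInverse (tailGram Φ x) * tailGram Φ x = Q ∧
      tailGram Φ x * moorePenroseInverse (tailGram Φ x) = Q :=
  moorePenroseInverse_eq_inverse_mul h.proj_mul_self h.proj_conjTranspose
    (h.proj_mul_tailGram hx) (h.tailGram_mul_proj hx) (h.isUnit_tailGram hx)

theorem IsBoundState.hasDerivWithinAt_tailGram (h : IsBoundState V κ f Φ K Q) {x : ℝ}
    (hx : 0 ≤ x) : HasDerivWithinAt (tailGram Φ) (-((Φ x)ᴴ * Φ x)) (Ici 0) x := by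
  have h1 := (hasDerivWithinAt_integral h.continuousOn_gram hx).const_sub (tailGram Φ 0)
  have e : ∀ t ∈ Ici (0 : ℝ), tailGram Φ t =
      tailGram Φ 0 - ∫ s in (0 : ℝ)..t, (Φ s)ᴴ * Φ s := by
    intro t ht
    rw [tailGram, tailGram, ← intervalIntegral.integral_interval_add_Ioi h.integrableOn_gram
      (h.integrableOn_gram_Ioi ht)]
    abel
  exact h1.congr e (e x hx)

theorem hasDerivWithinAt_ringInverse {S : ℝ → Mat n} {S' : Mat n} {s : Set ℝ} {x : ℝ}
    (hS : HasDerivWithinAt S S' s x) (hU : IsUnit (S x)) :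
    HasDerivWithinAt (fun t => Ring.inverse (S t))
      (-(Ring.inverse (S x) * S' * Ring.inverse (S x))) s x := by
  obtain ⟨U, hU'⟩ := hU
  have h1 := hasFDerivAt_ringInverse (𝕜 := ℝ) U
  rw [hU'] at h1
  refine (h1.comp_hasDerivWithinAt x hS).congr_deriv ?_
  rw [← hU', Ring.inverse_unit]
  simp

theorem IsBoundState.hderiv_eq_mul (h : IsBoundState V κ f Φ K Q) {x : ℝ} (hx : 0 ≤ x) :
    hderiv Φ x = hderiv f x * K := by
  refine hderiv_eq hx ?_
  exact ((h.jost.isSolution.hasDerivWithinAt hx).mul_const K).congr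
    (fun t ht => h.eq_mul t ht) (h.eq_mul x hx)

theorem IsBoundState.isDarbouxData (h : IsBoundState V κ f Φ K Q) :
    IsDarbouxData V κ Φ fun x => moorePenroseInverse (tailGram Φ x) where
  selfadjoint := h.selfadjoint
  isSolution := h.isSolution
  wronskian x hx := by
    have w := h.jost.wronskian_self h.pos h.integrable h.selfadjoint hx
    rw [h.hderiv_eq_mul hx, h.eq_mul x hx, Matrix.conjTranspose_mul, Matrix.conjTranspose_mul,
      mul_assoc, ← mul_assoc (f x)ᴴ, w]
    simp only [mul_assoc]
  riccati x hx := by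
    have h1 := (hasDerivWithinAt_ringInverse
      ((h.hasDerivWithinAt_tailGram hx).add_const (1 - Q)) (h.isUnit_tailGram hx)).mul_const Q
    have e : ∀ t ∈ Ici (0 : ℝ), moorePenroseInverse (tailGram Φ t) =
        Ring.inverse (tailGram Φ t + (1 - Q)) * Q :=
      fun t ht => (h.moorePenroseInverse_tailGram ht).1
    refine (h1.congr e (e x hx)).congr_deriv ?_
    rw [e x hx]
    simp only [mul_neg, neg_mul, neg_neg, mul_assoc]
    rw [← mul_assoc Q (Φ x)ᴴ, h.proj_mul_conjTranspose hx]
  hermitian x _ := moorePenroseInverse_conjTranspose (tailGram_conjTranspose Φ x)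

/-! ### Size of the perturbation -/

/-- `Φ†Φ - 2κ W` is small compared to `e^{-2κx}`: its derivative is `h†Φ + Φ†h` for the defect
`h = Φ' + κΦ`, which the tail of the potential controls. -/
theorem IsBoundState.norm_gram_sub_le (h : IsBoundState V κ f Φ K Q) {G : ℝ} (hG0 : 0 ≤ G)
    (hG : ∀ x, 0 ≤ x → ‖Φ x‖ ≤ G * Real.exp (-κ * x)) {x : ℝ} (hx : 0 ≤ x) :
    ‖(Φ x)ᴴ * Φ x - (2 * κ) • tailGram Φ x‖ ≤
      G ^ 2 / κ * Real.exp (-κ * x) ^ 2 * ∫ y in Ioi x, ‖V y‖ := by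
  have hκ := h.pos
  set d : ℝ → Mat n := fun t => hderiv Φ t + κ • Φ t with hd
  set r : ℝ → Mat n := fun t => (d t)ᴴ * Φ t + (Φ t)ᴴ * d t with hr
  have hdc : ContinuousOn d (Ici 0) :=
    h.isSolution.continuousOn_hderiv.add (h.isSolution.continuousOn.const_smul κ)
  have hrc : ContinuousOn r (Ici 0) :=
    ((continuousOn_conjTranspose hdc).mul h.isSolution.continuousOn).add
      ((continuousOn_conjTranspose h.isSolution.continuousOn).mul hdc)
  have hrn : ∀ s, 0 ≤ s → ∀ t, s ≤ t →
      ‖r t‖ ≤ 2 * G ^ 2 * (∫ y in Ioi s, ‖V y‖) * Real.exp (-κ * t) ^ 2 := by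
    intro s hs t hst
    have ht := hs.trans hst
    have n1 := h.isSolution.norm_hderiv_add_le hκ h.integrable hG0 hG ht
    have n2 : ‖d t‖ ≤ G * Real.exp (-κ * t) * ∫ y in Ioi s, ‖V y‖ :=
      n1.trans (mul_le_mul_of_nonneg_left (integral_Ioi_norm_anti h.integrable hs hst)
        (mul_nonneg hG0 (Real.exp_pos _).le))
    refine (norm_add_le_of_le (norm_conjTranspose_mul_le n2 (hG t ht))
      (norm_conjTranspose_mul_le (hG t ht) n2)).trans (le_of_eq ?_)
    ring
  have hri : IntegrableOn r (Ioi 0) :=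
    integrableOn_of_norm_le_exp hκ hrc fun t ht => hrn 0 le_rfl t ht
  have hgi := h.integrableOn_gram_Ioi hx
  have hri' := hri.mono_set (Ioi_subset_Ioi hx)
  have hder : ∀ t ∈ Ioi x, HasDerivAt (fun t => (Φ t)ᴴ * Φ t)
      (r t - (2 * κ) • ((Φ t)ᴴ * Φ t)) t := by
    intro t ht
    have ht0 : 0 < t := hx.trans_lt ht
    have h1 := h.isSolution.hasDerivAt ht0
    refine ((hasDerivAt_conjTranspose h1).mul h1).congr_deriv ?_
    simp only [hr, hd, Matrix.conjTranspose_add, Matrix.conjTranspose_smul, star_trivial, add_mul,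
      mul_add, smul_mul_assoc, mul_smul_comm]
    module
  have hlim : Tendsto (fun t => (Φ t)ᴴ * Φ t) atTop (𝓝 0) := by
    refine squeeze_zero_norm' (a := fun t => G * G * Real.exp (-(2 * κ * t))) ?_ ?_
    · filter_upwards [eventually_ge_atTop 0] with t ht
      refine (norm_conjTranspose_mul_le (hG t ht) (hG t ht)).trans (le_of_eq ?_)
      rw [← neg_mul, ← exp_neg_mul_sq]; ring
    · have : Tendsto (fun t : ℝ => Real.exp (-(2 * κ * t))) atTop (𝓝 0) :=
        Real.tendsto_exp_neg_atTop_nhds_zero.comp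
          (tendsto_id.const_mul_atTop (by linarith : 0 < 2 * κ))
      simpa using this.const_mul (G * G)
  have hFTC := integral_Ioi_of_hasDerivAt_of_tendsto
    ((h.continuousOn_gram x hx).mono (Ici_subset_Ici.mpr hx)) hder
    (hri'.sub (hgi.smul (2 * κ))) hlim
  have hgi' : IntegrableOn (fun t => (2 * κ) • ((Φ t)ᴴ * Φ t)) (Ioi x) := hgi.smul (2 * κ)
  rw [integral_sub hri' hgi', integral_smul, zero_sub] at hFTC
  have e : (Φ x)ᴴ * Φ x - (2 * κ) • tailGram Φ x = -∫ t in Ioi x, r t := by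
    rw [tailGram]
    rw [sub_eq_iff_eq_add.mp hFTC]
    abel
  rw [e, norm_neg]
  have h2 : -(2 * κ) < 0 := by linarith
  refine (norm_integral_le_of_norm_le
    (((integrableOn_exp_mul_Ioi h2 x)).const_mul (2 * G ^ 2 * ∫ y in Ioi x, ‖V y‖)) ?_).trans
    (le_of_eq ?_)
  · filter_upwards [ae_restrict_mem measurableSet_Ioi] with t ht
    rw [← exp_neg_mul_sq]
    exact hrn x hx t (le_of_lt ht)
  · rw [integral_const_mul, integral_exp_mul_Ioi h2, exp_neg_mul_sq]
    field_simp

/-- The generalized inverse of the tail Gram matrix grows at most like `e^{2κx}`: the matrices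
`2κ e^{2κx} W(x)` converge to `K†K`, which is invertible on the range of `Q`. -/
theorem IsBoundState.exists_norm_inverse_le (h : IsBoundState V κ f Φ K Q) :
    ∃ c, 0 ≤ c ∧ ∀ x, 0 ≤ x →
      ‖moorePenroseInverse (tailGram Φ x)‖ ≤ c * Real.exp (κ * x) ^ 2 := by
  have hκ := h.pos
  obtain ⟨G, hG0, hG⟩ := h.exists_norm_le
  have hee : ∀ x, Real.exp (κ * x) * Real.exp (-κ * x) = 1 := fun x => by
    rw [← Real.exp_add]; simp
  have t1 : Tendsto (fun x => Real.exp (κ * x) ^ 2 • ((Φ x)ᴴ * Φ x)) atTop (𝓝 (Kᴴ * K)) := by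
    have h1 := (h.jost.tendsto_exp_smul.mul_const K)
    have h2 := h1.star.mul h1
    rw [one_mul] at h2
    refine h2.congr' ?_
    filter_upwards [eventually_ge_atTop 0] with x hx
    rw [h.eq_mul x hx, smul_mul_assoc, star_smul, star_trivial, smul_mul_smul_comm, ← pow_two]
    rfl
  have t2 : Tendsto (fun x => Real.exp (κ * x) ^ 2 •
      ((Φ x)ᴴ * Φ x - (2 * κ) • tailGram Φ x)) atTop (𝓝 0) := by
    refine squeeze_zero_norm' (a := fun x => G ^ 2 / κ * ∫ y in Ioi x, ‖V y‖) ?_ ?_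
    · filter_upwards [eventually_ge_atTop 0] with x hx
      rw [norm_smul, Real.norm_eq_abs, abs_of_nonneg (by positivity)]
      refine (mul_le_mul_of_nonneg_left (h.norm_gram_sub_le hG0 hG hx) (by positivity)).trans
        (le_of_eq ?_)
      calc _ = (Real.exp (κ * x) * Real.exp (-κ * x)) ^ 2 * (G ^ 2 / κ * ∫ y in Ioi x, ‖V y‖) := by
            ring
        _ = _ := by rw [hee, one_pow, one_mul]
    · simpa using (tendsto_integral_Ioi_norm h.integrable).const_mul (G ^ 2 / κ)
  have t3 : Tendsto (fun x => (Real.exp (κ * x) ^ 2 * (2 * κ)) • tailGram Φ x + (1 - Q)) atTop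
      (𝓝 (Kᴴ * K + (1 - Q))) := by
    have := (t1.sub t2).add_const (1 - Q)
    rw [sub_zero] at this
    refine this.congr fun x => ?_
    rw [smul_sub, sub_sub_cancel, smul_smul]
  have hU : IsUnit (Kᴴ * K + (1 - Q)) := by
    refine isUnit_add_one_sub h.proj_mul_self ?_ fun v hv hQv => ?_
    · have := congrArg Matrix.conjTranspose h.mul_proj
      rw [Matrix.conjTranspose_mul, h.proj_conjTranspose] at this
      rw [← mul_assoc, this]
    · exact h.injective v ((Matrix.conjTranspose_mul_self_mulVec_eq_zero K v).mp hv) hQv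
  have t4 : Tendsto (fun x => (Real.exp (κ * x) ^ 2 * (2 * κ))⁻¹ •
      moorePenroseInverse (tailGram Φ x)) atTop
      (𝓝 (Ring.inverse (Kᴴ * K + (1 - Q)) * Q)) := by
    obtain ⟨U, hU'⟩ := hU
    have hinv := NormedRing.inverse_continuousAt U
    rw [hU'] at hinv
    refine ((hinv.tendsto.comp t3).mul_const Q).congr' ?_
    filter_upwards [eventually_ge_atTop 0,
      t3.eventually (Units.isOpen.mem_nhds ⟨U, hU'⟩)] with x hx hux
    have hpos : Real.exp (κ * x) ^ 2 * (2 * κ) ≠ 0 := by positivity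
    obtain ⟨-, p1, -, p2⟩ := h.moorePenroseInverse_tailGram hx
    refine (IsUnit.mul_left_cancel hux ?_)
    rw [Function.comp_apply, ← mul_assoc, Ring.mul_inverse_cancel _ hux, one_mul, add_mul,
      smul_mul_smul_comm, p2, mul_inv_cancel₀ hpos, one_smul, mul_smul_comm, sub_mul, one_mul, p1,
      sub_self, smul_zero, add_zero]
  have hcont : ContinuousOn (fun x => (Real.exp (κ * x) ^ 2 * (2 * κ))⁻¹ •
      moorePenroseInverse (tailGram Φ x)) (Ici 0) := by
    have h1 : ContinuousOn (fun x => moorePenroseInverse (tailGram Φ x)) (Ici 0) :=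
      fun x hx => (h.isDarbouxData.riccati x hx).continuousWithinAt
    have h2 : ContinuousOn (fun x => (Real.exp (κ * x) ^ 2 * (2 * κ))⁻¹) (Ici 0) :=
      ContinuousOn.inv₀ (by fun_prop) fun x _ => by positivity
    exact h2.smul h1
  obtain ⟨c, hc0, hc⟩ := exists_bound_of_tendsto hcont t4
  refine ⟨c * (2 * κ), by positivity, fun x hx => ?_⟩
  have h1 := hc x hx
  rw [norm_smul, norm_inv, Real.norm_eq_abs, abs_of_nonneg (by positivity),
    inv_mul_le_iff₀ (by positivity)] at h1
  refine h1.trans (le_of_eq ?_)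
  ring

/-- The derivative of `Φ W⁺ Φ†` is controlled by the tail of the potential. With the defect
`h = Φ' + κΦ` it equals `h W⁺Φ† + ΦW⁺ h† + ΦW⁺(Φ†Φ - 2κW)W⁺Φ†`, and each term is small. -/
theorem IsBoundState.exists_norm_diagDeriv_le (h : IsBoundState V κ f Φ K Q) :
    ∃ c, 0 ≤ c ∧ ∀ x, 0 ≤ x →
      ‖darbouxDiagDeriv Φ (fun t => moorePenroseInverse (tailGram Φ t)) x‖ ≤
        c * ∫ y in Ioi x, ‖V y‖ := by
  have hκ := h.pos
  obtain ⟨G, hG0, hG⟩ := h.exists_norm_le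
  obtain ⟨c, hc0, hc⟩ := h.exists_norm_inverse_le
  refine ⟨2 * G ^ 2 * c + G ^ 4 * c ^ 2 / κ, by positivity, fun x hx => ?_⟩
  obtain ⟨-, p1, p2, -⟩ := h.moorePenroseInverse_tailGram hx
  have nP := hc x hx
  have nΦ := hG x hx
  have nd := h.isSolution.norm_hderiv_add_le hκ h.integrable hG0 hG hx
  have ng := h.norm_gram_sub_le hG0 hG hx
  have hσ := integral_Ioi_norm_nonneg V x
  simp only [darbouxDiagDeriv, darbouxFactorDeriv]
  set P := moorePenroseInverse (tailGram Φ x)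
  set W := tailGram Φ x
  set σ := ∫ y in Ioi x, ‖V y‖
  set d := hderiv Φ x + κ • Φ x with hd
  have e : (hderiv Φ x * P + Φ x * P * (Φ x)ᴴ * (Φ x * P)) * (Φ x)ᴴ + Φ x * P * (hderiv Φ x)ᴴ =
      d * P * (Φ x)ᴴ + Φ x * P * dᴴ +
        Φ x * P * ((Φ x)ᴴ * Φ x - (2 * κ) • W) * P * (Φ x)ᴴ := by
    have hPWP : P * (W * (P * (Φ x)ᴴ)) = P * (Φ x)ᴴ := by
      rw [← mul_assoc, p2, ← mul_assoc, p1]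
    simp only [hd, add_mul, mul_add, mul_sub, sub_mul, Matrix.conjTranspose_add,
      Matrix.conjTranspose_smul, star_trivial, smul_mul_assoc, mul_smul_comm, mul_assoc, hPWP]
    module
  rw [e]
  set a := Real.exp (-κ * x) with ha
  set b := Real.exp (κ * x) with hb
  have ha0 : 0 ≤ a := (Real.exp_pos _).le
  have hab : a * b = 1 := by rw [ha, hb, ← Real.exp_add]; simp
  have hGa : 0 ≤ G * a := by positivity
  have hcb : 0 ≤ c * b ^ 2 := by positivity
  have nP' : ‖P * (Φ x)ᴴ‖ ≤ c * b ^ 2 * (G * a) := by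
    refine (norm_mul_le _ _).trans ?_
    rw [norm_conjTranspose]
    exact mul_le_mul nP nΦ (norm_nonneg _) hcb
  have nP'' : ‖Φ x * P‖ ≤ G * a * (c * b ^ 2) :=
    (norm_mul_le _ _).trans (mul_le_mul nΦ nP (norm_nonneg _) hGa)
  have m1 : ‖d * P * (Φ x)ᴴ‖ ≤ G * a * σ * (c * b ^ 2 * (G * a)) := by
    rw [mul_assoc]
    exact (norm_mul_le _ _).trans (mul_le_mul nd nP' (norm_nonneg _) (by positivity))
  have m2 : ‖Φ x * P * dᴴ‖ ≤ G * a * (c * b ^ 2) * (G * a * σ) := by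
    refine (norm_mul_le _ _).trans ?_
    rw [norm_conjTranspose]
    exact mul_le_mul nP'' nd (norm_nonneg _) (by positivity)
  have m3 : ‖Φ x * P * ((Φ x)ᴴ * Φ x - (2 * κ) • W) * P * (Φ x)ᴴ‖ ≤
      G * a * (c * b ^ 2) * (G ^ 2 / κ * a ^ 2 * σ) * (c * b ^ 2 * (G * a)) := by
    rw [mul_assoc _ P]
    refine (norm_mul_le _ _).trans (mul_le_mul ?_ nP' (norm_nonneg _) (by positivity))
    exact (norm_mul_le _ _).trans (mul_le_mul nP'' ng (norm_nonneg _) (by positivity))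
  refine (norm_add₃_le.trans (add_le_add (add_le_add m1 m2) m3)).trans (le_of_eq ?_)
  calc _ = 2 * G ^ 2 * c * (a * b) ^ 2 * σ + G ^ 4 * c ^ 2 / κ * (a * b) ^ 4 * σ := by ring
    _ = _ := by rw [hab]; ring

end BoundState

/-! ### Weighted integrability of the tail of the potential -/

/-- By Tonelli, `∫ (1+x)^ε ∫_x^∞ |V| = ∫ |V(y)| ∫_0^y (1+x)^ε`, and the inner integral is at most
`(1+y)^{1+ε}`. -/
theorem InWeightedL1.integrableOn_tail {n : ℕ} {V : ℝ → Mat n} {ε : ℝ} (hε : 0 ≤ ε)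
    (hV : InWeightedL1 (1 + ε) V) :
    IntegrableOn (fun x : ℝ => (1 + x) ^ ε * ∫ y in Ioi x, ‖V y‖) (Ioi 0) := by
  set μ : Measure ℝ := volume.restrict (Ioi 0) with hμ
  set g : ℝ × ℝ → ℝ := fun p => (1 + p.1) ^ ε * ‖V p.2‖ with hg
  set T : Set (ℝ × ℝ) := {p | p.1 < p.2} with hT
  have hTm : MeasurableSet T := measurableSet_lt measurable_fst measurable_snd
  have hgm : AEStronglyMeasurable g (μ.prod μ) := by
    refine AEStronglyMeasurable.mul ?_ hV.1.norm.comp_snd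
    exact ((measurable_fst.const_add 1).pow_const ε).aestronglyMeasurable
  have hFm : AEStronglyMeasurable (T.indicator g) (μ.prod μ) := hgm.indicator hTm
  have hpow : ContinuousOn (fun x : ℝ => (1 + x) ^ ε) (Ici 0) :=
    ContinuousOn.rpow_const (by fun_prop) fun x _ => Or.inr hε
  have hsec : ∀ y, (fun x => T.indicator g (x, y)) =
      (Iio y).indicator fun x => (1 + x) ^ ε * ‖V y‖ := by
    intro y; ext x; simp [indicator, hT, hg]
  have hpi : ∀ y, IntegrableOn (fun x : ℝ => (1 + x) ^ ε) (Ioc 0 y) := fun y =>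
    ((hpow.mono Icc_subset_Ici_self).integrableOn_Icc (b := y)).mono_set Ioc_subset_Icc_self
  have hset : ∀ y, Iio y ∩ Ioi (0 : ℝ) ⊆ Ioc 0 y := fun y x hx => ⟨hx.2, le_of_lt hx.1⟩
  have hsi : ∀ y, Integrable (fun x => T.indicator g (x, y)) μ := by
    intro y
    rw [hsec, integrable_indicator_iff measurableSet_Iio, IntegrableOn, hμ,
      Measure.restrict_restrict measurableSet_Iio]
    exact ((hpi y).mono_set (hset y)).mul_const _
  have hF : Integrable (T.indicator g) (μ.prod μ) := by
    refine (integrable_prod_iff' hFm).mpr ⟨Eventually.of_forall hsi, ?_⟩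
    refine Integrable.mono' hV.2 hFm.norm.prod_swap.integral_prod_right' ?_
    filter_upwards [ae_restrict_mem measurableSet_Ioi] with y hy
    have hy : 0 < y := hy
    rw [Real.norm_eq_abs, abs_of_nonneg (integral_nonneg fun _ => norm_nonneg _)]
    have e1 : ∫ x, ‖T.indicator g (x, y)‖ ∂μ =
        ∫ x in Iio y ∩ Ioi 0, (1 + x) ^ ε * ‖V y‖ := by
      rw [← Measure.restrict_restrict measurableSet_Iio, ← integral_indicator measurableSet_Iio]
      refine integral_congr_ae ?_
      filter_upwards [ae_restrict_mem measurableSet_Ioi] with x hx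
      have hx : 0 < x := hx
      rw [congrFun (hsec y) x]
      by_cases hxy : x ∈ Iio y
      · rw [indicator_of_mem hxy, Real.norm_of_nonneg (by positivity)]
      · rw [indicator_of_notMem hxy, norm_zero]
    rw [e1]
    have e2 : ∫ x in Iio y ∩ Ioi 0, (1 + x) ^ ε * ‖V y‖ ≤
        ∫ _x in Ioc 0 y, (1 + y) ^ ε * ‖V y‖ := by
      refine (setIntegral_mono_set ((hpi y).mul_const _) ?_ (hset y).eventuallyLE).trans
        (setIntegral_mono_on ((hpi y).mul_const _) (integrableOn_const (by simp))
          measurableSet_Ioc fun x hx => ?_)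
      · filter_upwards [ae_restrict_mem measurableSet_Ioc] with x hx
        have := hx.1
        exact mul_nonneg (Real.rpow_nonneg (by linarith) _) (norm_nonneg _)
      · have := hx.1
        exact mul_le_mul_of_nonneg_right
          (Real.rpow_le_rpow (by linarith) (by linarith [hx.2]) hε) (norm_nonneg _)
    refine e2.trans ?_
    rw [setIntegral_const, smul_eq_mul, Real.volume_real_Ioc_of_le hy.le, sub_zero, ← mul_assoc]
    refine mul_le_mul_of_nonneg_right ?_ (norm_nonneg _)
    rw [Real.rpow_add (by linarith), Real.rpow_one]
    exact mul_le_mul_of_nonneg_right (by linarith) (Real.rpow_nonneg (by linarith) _)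
  refine hF.integral_prod_left.congr ?_
  filter_upwards [ae_restrict_mem measurableSet_Ioi] with x hx
  have hx : 0 < x := hx
  have e : (fun y => T.indicator g (x, y)) = (Ioi x).indicator fun y => (1 + x) ^ ε * ‖V y‖ := by
    ext y; simp [indicator, hT, hg]
  rw [e, integral_indicator measurableSet_Ioi, hμ, Measure.restrict_restrict measurableSet_Ioi,
    inter_eq_left.mpr (Ioi_subset_Ioi hx.le), integral_const_mul]

theorem integral_Ioi_norm_le_exp {n : ℕ} {V : ℝ → Mat n} (hV : IntegrableOn V (Ioi 0))
    {α x₀ c : ℝ} (hα : 0 < α) (hx₀ : 0 < x₀)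
    (hle : ∀ᵐ x ∂volume.restrict (Ici x₀), ‖V x‖ ≤ c * Real.exp (-α * x)) {x : ℝ} (hx : x₀ ≤ x) :
    ∫ y in Ioi x, ‖V y‖ ≤ c / α * Real.exp (-α * x) := by
  have hα' : -α < 0 := by linarith
  have h1 : ∫ y in Ioi x, ‖V y‖ ≤ ∫ y in Ioi x, c * Real.exp (-α * y) := by
    refine integral_mono_ae (hV.mono_set (Ioi_subset_Ioi (hx₀.le.trans hx))).norm
      ((integrableOn_exp_mul_Ioi hα' x).const_mul c) ?_
    exact ae_restrict_of_ae_restrict_of_subset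
      (fun t (ht : x < t) => hx.trans ht.le) hle
  refine h1.trans (le_of_eq ?_)
  rw [integral_const_mul, integral_exp_mul_Ioi hα']
  field_simp

/-! ### Normalized bound states -/

section Normalized

variable {n : ℕ} {V : ℝ → Mat n} {A B : Mat n} {κ : ℝ} {f φ : ℝ → Mat n} {Q : Mat n}

theorem mulVec_eq_zero_of_gram_add {M N : Mat n} {v : Fin n → ℂ}
    (hv : (Mᴴ * M + Nᴴ * N) *ᵥ v = 0) : M *ᵥ v = 0 ∧ N *ᵥ v = 0 := by
  have h1 := congrArg (fun w => star v ⬝ᵥ w) hv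
  simp only [Matrix.add_mulVec, dotProduct_add, dotProduct_zero] at h1
  rw [← quadraticForm_apply, ← quadraticForm_apply, quadraticForm_conjTranspose_mul_self,
    quadraticForm_conjTranspose_mul_self, add_eq_zero_iff_of_nonneg
      (dotProduct_star_self_nonneg _) (dotProduct_star_self_nonneg _)] at h1
  exact ⟨dotProduct_star_self_eq_zero.mp h1.1, dotProduct_star_self_eq_zero.mp h1.2⟩

theorem IsBoundaryPair.eq_zero_of_mulVec (hAB : IsBoundaryPair A B) {v : Fin n → ℂ}
    (hA : A *ᵥ v = 0) (hB : B *ᵥ v = 0) : v = 0 := by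
  refine Matrix.mulVec_injective_of_isUnit hAB.posDef.isUnit ?_
  rw [Matrix.add_mulVec, ← Matrix.mulVec_mulVec, ← Matrix.mulVec_mulVec, hA, hB]
  simp

/-- The columns of a regular solution selected by `Ker J(iκ)` are multiples of the Jost solution:
`J(iκ)` is the Wronskian of the two. -/
theorem IsRegularSolution.isBoundState (hκ : 0 < κ) (hVsa : ∀ x : ℝ, 0 < x → (V x)ᴴ = V x)
    (hV : IntegrableOn V (Ioi 0)) (hAB : IsBoundaryPair A B)
    (hf : IsJostSolution V (Complex.I * κ) f)
    (hφ : IsRegularSolution V A B (Complex.I * κ) φ) (hQQ : Q * Q = Q) (hQ : Qᴴ = Q)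
    (hJ : ((f 0)ᴴ * B - (hderiv f 0)ᴴ * A) * Q = 0) {C S : Mat n} (hQC : Q * C = C)
    (hCQ : C * Q = C) (hSC : S * C = Q) :
    ∃ K, IsBoundState V κ f (fun x => φ x * C) K Q := by
  have hu := hφ.isSolution.mul_right Q
  obtain ⟨K, hK⟩ := hf.eq_mul_of_wronskian hκ hV hVsa hu (by
    rw [hφ.isSolution.hderiv_mul_right Q le_rfl, hφ.value_zero, hφ.deriv_zero, ← mul_assoc,
      ← mul_assoc, ← sub_mul, hJ])
  refine ⟨K * C, hκ, hV, hVsa, hf, hφ.isSolution.mul_right C, fun x hx => ?_, ?_, hQQ, hQ,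
    fun v hv hQv => ?_⟩
  · rw [← mul_assoc, ← hK x hx, mul_assoc, hQC]
  · rw [mul_assoc, hCQ]
  · have hzero : ∀ x, 0 ≤ x → φ x *ᵥ (C *ᵥ v) = 0 := fun x hx => by
      rw [Matrix.mulVec_mulVec, ← hQC, ← mul_assoc, hK x hx, mul_assoc, ← Matrix.mulVec_mulVec,
        hv, Matrix.mulVec_zero]
    have hA : A *ᵥ (C *ᵥ v) = 0 := by rw [← hφ.value_zero]; exact hzero 0 le_rfl
    have hB : B *ᵥ (C *ᵥ v) = 0 := by
      -- `φ C v` vanishes identically; the vector `C v` is repeated in all columns of a matrix.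
      have h1 : hderiv (fun t => φ t * (Matrix.of fun i (_ : Fin n) => (C *ᵥ v) i)) 0 = 0 := by
        refine hderiv_eq le_rfl ((hasDerivWithinAt_const (0 : ℝ) (Ici 0) (0 : Mat n)).congr ?_ ?_)
        · intro x hx
          ext i j
          exact congrFun (hzero x hx) i
        · ext i j
          exact congrFun (hzero 0 le_rfl) i
      rw [hφ.isSolution.hderiv_mul_right _ le_rfl, hφ.deriv_zero] at h1
      ext i
      exact congrFun (congrFun h1 i) i
    have hCv := hAB.eq_zero_of_mulVec hA hB
    rw [← hQv, ← hSC, ← Matrix.mulVec_mulVec, hCv, Matrix.mulVec_zero]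

/-- The normalization `C` of the bound state: it is hermitian, invertible on the range of `Q`, and
makes the full Gram matrix of `φ C` equal to `Q`. -/
theorem IsRegularSolution.glNormalization_properties (hκ : 0 < κ)
    (hVsa : ∀ x : ℝ, 0 < x → (V x)ᴴ = V x)
    (hV : IntegrableOn V (Ioi 0)) (hAB : IsBoundaryPair A B)
    (hf : IsJostSolution V (Complex.I * κ) f)
    (hφ : IsRegularSolution V A B (Complex.I * κ) φ) (hQQ : Q * Q = Q) (hQ : Qᴴ = Q)
    (hJ : ((f 0)ᴴ * B - (hderiv f 0)ᴴ * A) * Q = 0) :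
    (glNormalization φ Q)ᴴ = glNormalization φ Q ∧
      (∃ K, IsBoundState V κ f (fun x => φ x * glNormalization φ Q) K Q) ∧
      tailGram (fun x => φ x * glNormalization φ Q) 0 = Q ∧
      Q * glNormalization φ Q = glNormalization φ Q ∧
      glNormalization φ Q * Q = glNormalization φ Q := by
  obtain ⟨K, hK⟩ := IsRegularSolution.isBoundState hκ hVsa hV hAB hf hφ hQQ hQ hJ hQQ hQQ hQQ
  have hG : ∫ x in Ioi (0 : ℝ), Q * (φ x)ᴴ * φ x * Q = tailGram (fun x => φ x * Q) 0 := by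
    rw [tailGram]
    congr 1
    ext1 x
    rw [Matrix.conjTranspose_mul, hQ, ← mul_assoc]
  obtain ⟨c1, c2, c3, c4, S, c5⟩ := sqrt_inv_mul_properties hQQ hQ (hK.proj_mul_tailGram le_rfl)
    (hK.tailGram_mul_proj le_rfl) (posSemidef_integral_gram hK.integrableOn_gram)
    (by rw [add_comm]; exact hK.isUnit_tailGram le_rfl)
  have hC : glNormalization φ Q =
      (CFC.sqrt (1 - Q + tailGram (fun x => φ x * Q) 0))⁻¹ * Q := by
    rw [glNormalization, hG]
  rw [← hC] at c1 c2 c3 c4 c5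
  refine ⟨c1, IsRegularSolution.isBoundState hκ hVsa hV hAB hf hφ hQQ hQ hJ c2 c3 c5, ?_, c2, c3⟩
  refine Eq.trans ?_ c4
  rw [tailGram, tailGram, ← integral_const_mul_of_integrable hK.integrableOn_gram,
    ← integral_mul_const_of_integrable (hK.integrableOn_gram.const_mul _)]
  refine setIntegral_congr_fun measurableSet_Ioi fun z _ => ?_
  rw [Matrix.conjTranspose_mul, Matrix.conjTranspose_mul, c1, hQ]
  calc glNormalization φ Q * (φ z)ᴴ * (φ z * glNormalization φ Q)
      = (glNormalization φ Q * Q) * (φ z)ᴴ * (φ z * (Q * glNormalization φ Q)) := by rw [c2, c3]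
    _ = _ := by simp only [mul_assoc]

end Normalized

end MatrixSchrodinger

/-! ### Removal of a bound state -/

theorem theorem6p3 {n : ℕ}
    -- the unperturbed operator
    (V : ℝ → Mat n) (A B : Mat n)
    (hVsa : ∀ x : ℝ, 0 < x → (V x)ᴴ = V x) (hV : InWeightedL1 1 V) (hAB : IsBoundaryPair A B)
    -- its regular solution and its Jost solution
    (φ : ℂ → ℝ → Mat n) (hφ : ∀ k : ℂ, IsRegularSolution V A B k (φ k))
    (f : ℂ → ℝ → Mat n) (hf : ∀ k : ℂ, 0 ≤ k.im → k ≠ 0 → IsJostSolution V k (f k))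
    -- the bound state at `k = iκ` that is removed
    (κ : ℝ) (hκ : 0 < κ) (hbound : (jostMatrix f A B (Complex.I * κ)).det = 0)
    (Q C : Mat n) (hQ : Q = kerProjection (jostMatrix f A B (Complex.I * κ)))
    (hC : C = glNormalization (φ (Complex.I * κ)) Q)
    (Φ : ℝ → Mat n) (hΦ : Φ = fun x => φ (Complex.I * κ) x * C)
    -- the perturbed quantities
    (Vt : ℝ → Mat n) (hVt : Vt = perturbedPotential V Φ)
    (φt : ℂ → ℝ → Mat n) (hφt : φt = fun k => perturbedSolution Φ (φ k)) :
    -- the derivative in the definition of the perturbed potential exists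
    (∀ x : ℝ, 0 < x → DifferentiableAt ℝ (fun t : ℝ => removalKernel Φ t t) x) ∧
    -- (a)
    (∀ k : ℂ, IsSolution Vt k (φt k)) ∧
    (∀ k : ℂ, ∀ x : ℝ, 0 ≤ x →
      φt k x = φ k x + Φ x * moorePenroseInverse (tailGram Φ x) *
        ∫ y in (0 : ℝ)..x, (Φ y)ᴴ * φ k y) ∧
    -- (b)
    (∀ x : ℝ, 0 < x → (Vt x)ᴴ = Vt x) ∧
    ((fun x : ℝ => Vt x - V x) =O[atTop] fun x : ℝ => ∫ y in Ioi x, ‖V y‖) ∧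
    (∀ ε : ℝ, 0 ≤ ε → InWeightedL1 (1 + ε) V → InWeightedL1 ε Vt) ∧
    -- (c)
    (∀ α x₀ c : ℝ, 0 < α → 0 < x₀ →
      (∀ᵐ x ∂volume.restrict (Ici x₀), ‖V x‖ ≤ c * Real.exp (-α * x)) →
      ∃ c' : ℝ, ∀ x : ℝ, x₀ ≤ x → ‖Vt x - V x‖ ≤ c' * Real.exp (-α * x)) ∧
    -- (d), for the essential support and for the pointwise support
    (∀ x₀ : ℝ, 0 < x₀ →
      ((∀ᵐ x ∂volume.restrict (Ioi x₀), V x = 0) → ∀ᵐ x ∂volume.restrict (Ioi x₀), Vt x = 0) ∧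
      ((∀ x : ℝ, x₀ < x → V x = 0) → ∀ x : ℝ, x₀ < x → Vt x = 0)) ∧
    -- (e)
    (∀ k : ℂ, k ≠ Complex.I * κ → k ≠ -(Complex.I * κ) → ∀ x : ℝ, 0 ≤ x →
      φt k x = φ k x + (1 / (k ^ 2 + (κ : ℂ) ^ 2)) •
        (Φ x * moorePenroseInverse (tailGram Φ x) *
          ((hderiv Φ x)ᴴ * φ k x - (Φ x)ᴴ * hderiv (φ k) x))) ∧
    -- (f)
    (∀ k : ℂ, φt k 0 = A ∧ hderiv (φt k) 0 = B + A * C ^ 2 * Aᴴ * A) ∧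
    -- (g)
    IsBoundaryPair A (B + A * C ^ 2 * Aᴴ * A) ∧
    (∀ k : ℂ, IsRegularSolution Vt A (B + A * C ^ 2 * Aᴴ * A) k (φt k) ∧
      SatisfiesBoundaryCondition A (B + A * C ^ 2 * Aᴴ * A) (φt k)) := by
  have hVi : IntegrableOn V (Ioi 0) := hV.integrableOn zero_le_one
  have hκ0 : Complex.I * (κ : ℂ) ≠ 0 := by simp [hκ.ne']
  have hfj : IsJostSolution V (Complex.I * κ) (f (Complex.I * κ)) :=
    hf _ (by simpa using hκ.le) hκ0
  -- On the imaginary axis `-k* = k`, so that `J(iκ)` involves the Jost solution at `iκ` itself.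
  have hstar : -(star (Complex.I * (κ : ℂ))) = Complex.I * κ := by simp
  have hJ : ((f (Complex.I * κ) 0)ᴴ * B - (hderiv (f (Complex.I * κ)) 0)ᴴ * A) * Q = 0 := by
    have h1 := mul_kerProjection (jostMatrix f A B (Complex.I * κ))
    rw [← hQ] at h1
    rwa [jostMatrix, hstar] at h1
  have hQQ : Q * Q = Q := by rw [hQ]; exact kerProjection_mul_self _
  have hQs : Qᴴ = Q := by rw [hQ]; exact kerProjection_conjTranspose _
  obtain ⟨hCs, ⟨K, hK⟩, hW0, hQC, hCQ⟩ := IsRegularSolution.glNormalization_properties hκ hVsa hVi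
    hAB hfj (hφ (Complex.I * κ)) hQQ hQs hJ
  rw [← hC] at hCs hK hW0 hQC hCQ
  rw [← hΦ] at hK hW0
  have hD := hK.isDarbouxData
  set P : ℝ → Mat n := fun x => moorePenroseInverse (tailGram Φ x) with hP
  have hVt' : ∀ x, 0 < x → Vt x = V x + (2 : ℝ) • darbouxDiagDeriv Φ P x := fun x hx => by
    rw [hVt, perturbedPotential]
    exact congrArg (fun D => V x + (2 : ℝ) • D) (hD.hasDerivAt_diag hx).deriv
  -- The integral form of the transform is the definition, with `Φ W⁺` moved out of the integral.
  have hφt' : ∀ k x, 0 ≤ x → φt k x = darbouxTransform Φ P (φ k) x := by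
    intro k x hx
    have hi : IntervalIntegrable (fun y => (Φ y)ᴴ * φ k y) volume 0 x :=
      ((hD.continuousOn_integrand (hφ k).isSolution).mono
        (by rw [uIcc_of_le hx]; exact Icc_subset_Ici_self)).intervalIntegrable
    rw [hφt]
    change perturbedSolution Φ (φ k) x = _
    rw [perturbedSolution, darbouxTransform, intervalIntegral.integral_of_le hx,
      intervalIntegral.integral_of_le hx, ← integral_const_mul_of_integrable hi.1]
    simp only [removalKernel, mul_assoc, hP]
  have hΦ0 : Φ 0 = A * C := by rw [hΦ, ← (hφ (Complex.I * κ)).value_zero]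
  have hΦ'0 : hderiv Φ 0 = B * C := by
    rw [hΦ, (hφ _).isSolution.hderiv_mul_right C le_rfl, (hφ _).deriv_zero]
  have hBA : Aᴴ * B = Bᴴ * A := by
    have := hAB.selfadjoint
    rw [neg_mul, neg_add_eq_zero] at this
    exact this.symm
  -- This is where the selfadjointness condition on `A` and `B` enters.
  have hw0 : ∀ k, (Φ 0)ᴴ * hderiv (φ k) 0 - (hderiv Φ 0)ᴴ * φ k 0 = 0 := fun k => by
    rw [hΦ0, hΦ'0, (hφ k).value_zero, (hφ k).deriv_zero, Matrix.conjTranspose_mul,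
      Matrix.conjTranspose_mul, mul_assoc, mul_assoc, hBA, sub_self]
  obtain ⟨c, hc0, hc⟩ := hK.exists_norm_diagDeriv_le
  have hdiff : ∀ x, 0 < x → Vt x - V x = (2 : ℝ) • darbouxDiagDeriv Φ P x := fun x hx => by
    rw [hVt' x hx, add_sub_cancel_left]
  have hdn : ∀ x, 0 < x → ‖Vt x - V x‖ ≤ 2 * c * ∫ y in Ioi x, ‖V y‖ := fun x hx => by
    rw [hdiff x hx, norm_smul, Real.norm_two, mul_assoc]
    exact mul_le_mul_of_nonneg_left (hc x hx.le) zero_le_two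
  have hsol : ∀ k, IsSolution Vt k (φt k) := fun k =>
    (hD.isSolution_transform (hφ k).isSolution (hw0 k) hVt').congr (hφt' k)
  have hval : ∀ k, φt k 0 = A ∧ hderiv (φt k) 0 = B + A * C ^ 2 * Aᴴ * A := by
    intro k
    -- `W(0) = Q` is its own Moore–Penrose inverse.
    have hP0 : P 0 = Q := by
      have h1 : P 0 * tailGram Φ 0 = Q := (hK.moorePenroseInverse_tailGram le_rfl).2.2.1
      have h2 : tailGram Φ 0 * P 0 = Q := (hK.moorePenroseInverse_tailGram le_rfl).2.2.2
      have h3 : Q * P 0 = P 0 := (hK.moorePenroseInverse_tailGram le_rfl).2.1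
      rw [hW0] at h2
      rw [← h3, h2]
    refine ⟨?_, ?_⟩
    · rw [hφt' k 0 le_rfl, darbouxTransform, intervalIntegral.integral_same, mul_zero, add_zero,
        (hφ k).value_zero]
    · have h1 : hderiv (φt k) 0 = darbouxTransformDeriv Φ P (φ k) 0 :=
        hderiv_eq le_rfl ((hD.hasDerivWithinAt_transform (hφ k).isSolution le_rfl).congr
          (fun x hx => hφt' k x hx) (hφt' k 0 le_rfl))
      rw [h1, darbouxTransformDeriv, intervalIntegral.integral_same, mul_zero, add_zero,
        (hφ k).value_zero, (hφ k).deriv_zero, hP0, hΦ0, Matrix.conjTranspose_mul, hCs,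
        mul_assoc A C Q, hCQ, pow_two]
      simp only [mul_assoc]
  have hCC : (A * C ^ 2 * Aᴴ * A)ᴴ = Aᴴ * (A * C ^ 2 * Aᴴ) := by
    simp only [Matrix.conjTranspose_mul, Matrix.conjTranspose_conjTranspose,
      Matrix.conjTranspose_pow, hCs, mul_assoc]
  have hpair : IsBoundaryPair A (B + A * C ^ 2 * Aᴴ * A) := by
    have hsa : -(B + A * C ^ 2 * Aᴴ * A)ᴴ * A + Aᴴ * (B + A * C ^ 2 * Aᴴ * A) = 0 := by
      rw [Matrix.conjTranspose_add, hCC, mul_add, hBA, neg_mul, add_mul]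
      simp only [mul_assoc]
      abel
    refine ⟨hsa, ?_⟩
    refine ((Matrix.posSemidef_conjTranspose_mul_self _).add
      (Matrix.posSemidef_conjTranspose_mul_self _)).posDef_iff_isUnit.mpr ?_
    rw [← Matrix.mulVec_injective_iff_isUnit]
    refine (injective_iff_map_eq_zero (Matrix.mulVecLin _)).mpr fun v hv => ?_
    rw [Matrix.mulVecLin_apply] at hv
    obtain ⟨hA, hB⟩ := mulVec_eq_zero_of_gram_add hv
    refine hAB.eq_zero_of_mulVec hA ?_
    rwa [Matrix.add_mulVec, ← Matrix.mulVec_mulVec, hA, Matrix.mulVec_zero, add_zero] at hB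
  refine ⟨fun x hx => (hD.hasDerivAt_diag hx).differentiableAt, hsol, hφt', ?_, ?_, ?_, ?_, ?_, ?_,
    hval, hpair, fun k => ⟨⟨hsol k, (hval k).1, (hval k).2⟩, ?_⟩⟩
  · intro x hx
    rw [hVt' x hx, Matrix.conjTranspose_add, hVsa x hx, Matrix.conjTranspose_smul, star_trivial,
      hD.diagDeriv_conjTranspose hx.le]
  · refine Asymptotics.IsBigO.of_bound (2 * c) ?_
    filter_upwards [eventually_gt_atTop 0] with x hx
    rw [Real.norm_of_nonneg (integral_Ioi_norm_nonneg V x)]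
    exact hdn x hx
  · intro ε hε hVε
    have hm : AEStronglyMeasurable Vt (volume.restrict (Ioi 0)) := by
      have h1 : AEStronglyMeasurable (fun x => V x + (2 : ℝ) • darbouxDiagDeriv Φ P x)
          (volume.restrict (Ioi 0)) :=
        hV.1.add (((hD.continuousOn_diagDeriv.mono Ioi_subset_Ici_self).aestronglyMeasurable
          measurableSet_Ioi).const_smul (2 : ℝ))
      refine h1.congr ?_
      filter_upwards [ae_restrict_mem measurableSet_Ioi] with x hx using (hVt' x hx).symm
    have hpm : AEStronglyMeasurable (fun x : ℝ => (1 + x) ^ ε) (volume.restrict (Ioi 0)) :=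
      ((measurable_id.const_add 1).pow_const ε).aestronglyMeasurable
    refine ⟨hm, Integrable.mono' (hVε.2.add ((hVε.integrableOn_tail hε).const_mul (2 * c)))
      (hpm.mul hm.norm) ?_⟩
    filter_upwards [ae_restrict_mem measurableSet_Ioi] with x hx
    have hx : 0 < x := hx
    have h1 : (1 + x) ^ ε ≤ (1 + x) ^ (1 + ε) :=
      Real.rpow_le_rpow_of_exponent_le (by linarith) (by linarith)
    have h0 : 0 ≤ (1 + x) ^ ε := Real.rpow_nonneg (by linarith) _
    have h2 : ‖Vt x‖ ≤ ‖V x‖ + 2 * c * ∫ y in Ioi x, ‖V y‖ := by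
      have := norm_le_norm_add_norm_sub' (Vt x) (V x)
      linarith [hdn x hx]
    rw [Real.norm_of_nonneg (mul_nonneg h0 (norm_nonneg _)), Pi.add_apply]
    calc (1 + x) ^ ε * ‖Vt x‖
        ≤ (1 + x) ^ ε * (‖V x‖ + 2 * c * ∫ y in Ioi x, ‖V y‖) :=
          mul_le_mul_of_nonneg_left h2 h0
      _ = (1 + x) ^ ε * ‖V x‖ + 2 * c * ((1 + x) ^ ε * ∫ y in Ioi x, ‖V y‖) := by ring
      _ ≤ _ := add_le_add_left (mul_le_mul_of_nonneg_right h1 (norm_nonneg _)) _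
  · intro α x₀ b hα hx₀ hle
    refine ⟨2 * c * (b / α), fun x hx => ?_⟩
    refine (hdn x (hx₀.trans_le hx)).trans ?_
    rw [mul_assoc _ (b / α)]
    exact mul_le_mul_of_nonneg_left (integral_Ioi_norm_le_exp hVi hα hx₀ hle hx) (by positivity)
  · intro x₀ hx₀
    have key : (∀ᵐ x ∂volume.restrict (Ioi x₀), V x = 0) → ∀ x, x₀ < x → Vt x = V x := by
      intro h x hx
      have h1 : ∫ y in Ioi x, ‖V y‖ = 0 := by
        refine integral_eq_zero_of_ae ?_
        filter_upwards [ae_restrict_of_ae_restrict_of_subset (Ioi_subset_Ioi hx.le) h] with y hy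
        rw [hy, norm_zero, Pi.zero_apply]
      have h2 := hdn x (hx₀.trans hx)
      rw [h1, mul_zero] at h2
      exact sub_eq_zero.mp (norm_le_zero_iff.mp h2)
    refine ⟨fun h => ?_, fun h x hx => ?_⟩
    · filter_upwards [h, ae_restrict_mem measurableSet_Ioi] with x h1 hx
      rw [key h x hx, h1]
    · rw [key ((ae_restrict_mem measurableSet_Ioi).mono h) x hx, h x hx]
  · intro k hk1 hk2 x hx
    rw [hφt' k x hx, darbouxTransform]
    have hne : k ^ 2 + (κ : ℂ) ^ 2 ≠ 0 := by
      intro h0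
      have : (k - Complex.I * κ) * (k + Complex.I * κ) = 0 := by
        linear_combination h0 - (κ : ℂ) ^ 2 * Complex.I_sq
      rcases mul_eq_zero.mp this with h | h
      · exact hk1 (sub_eq_zero.mp h)
      · exact hk2 (eq_neg_of_add_eq_zero_left h)
    have h1 := hD.wronskian_eq_integral (hφ k).isSolution (hw0 k) hx
    have h2 : (hderiv Φ x)ᴴ * φ k x - (Φ x)ᴴ * hderiv (φ k) x =
        (k ^ 2 + (κ : ℂ) ^ 2) • ∫ y in (0 : ℝ)..x, (Φ y)ᴴ * φ k y := by
      rw [← neg_sub, h1, ← neg_smul]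
      congr 1
      linear_combination -(κ : ℂ) ^ 2 * Complex.I_sq
    rw [h2, mul_smul_comm, smul_smul, one_div, inv_mul_cancel₀ hne, one_smul]
  · rw [SatisfiesBoundaryCondition, (hval k).1, (hval k).2]
    exact hpair.selfadjoint
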